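/- Let $M:[0,\infty)\to[0,\infty)$ be continuous and increasing (non-decreasing and not identically zero suffices), with $M(t)+M(s)\le M(t+s)$ and $M(t+s)\le M(2t)+M(2s)$ for all $t,s\ge 0$, and write $M(\mathbf x)=M(|\mathbf x|)$ for $\mathbf x\in\mathbb R^n$. Let $\{V_j\}_{j\in\mathbb Z}$ be a multiresolution analysis of $L^2(\mathbb R^n)$, that is, an increasing sequence of closed subspaces such that $f\in V_j\Leftrightarrow f(2\,\cdot)\in V_{j+1}$; $f\in V_0\Leftrightarrow f(\cdot-\mathbf m)\in V_0$ for $\mathbf m\in\mathbb Z^n$; $\bigcap_j V_j=\{0\}$ and $\bigcup_j V_j$ is dense in $L^2(\mathbb R^n)$; and there is a scaling function, i.e. a function whose translates by $\mathbb Z^n$ are an orthonormal basis of $V_0$. Assume that it has a continuous scaling function $\phi$ with $\lim_{|\mathbf x|\to\infty}e^{M(l\mathbf x)}\phi(\mathbf x)=0$ for every $l\in\mathbb N$, and fix this $\phi$. For $\lambda\in\mathbb R$ put $$q_\lambda(\mathbf x,\mathbf y)=2^{n\lambda}q_0(2^\lambda\mathbf x,2^\lambda\mathbf y),\qquad q_0(\mathbf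 x,\mathbf y)=\sum_{\mathbf m\in\mathbb Z^n}\phi(\mathbf x-\mathbf m)\overline{\phi(\mathbf y-\mathbf m)} .$$ Let $\mu$ be a complex Radon measure on $\mathbb R^n$ (countably additive on bounded Borel sets, with total variation measure $|\mu|$ possibly infinite) such that $\int_{\mathbb R^n}e^{-M(k\mathbf x)}\,d|\mu|(\mathbf x)<\infty$ for some $k\ge 0$. Then the series for $q_0$ converges absolutely and each $q_\lambda(\mathbf x,\cdot)$ is $|\mu|$-integrable, so that $(q_\lambda\mu)(\mathbf x)=\int_{\mathbb R^n}q_\lambda(\mathbf x,\mathbf y)\,d\mu(\mathbf y)$ is well defined for all $\lambda\in\mathbb R$, $\mathbf x\in\mathbb R^n$. Let $m$ be Lebesgue measure. Borel sets $B_0,B_1,\dots$ shrink regularly to $\mathbf x_0$ if there are radii $\varepsilon_\nu>0$ with $\varepsilon_\nu\to 0$ and $a>0$ such that $B_\nu\subseteq B(\mathbf x_0,\varepsilon_\nu)$ and $m(B_\nu)\ge a\varepsilon_\nu^n$ for all $\nu$. Call $\mathbf x_0$ a Lebesgue density point of $\mu$, with value $\gamma_{\mathbf x_0}\in\mathbb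 C$, if $\mu(B_\nu)/m(B_\nu)\to\gamma_{\mathbf x_0}$ for every sequence of Borel sets shrinking regularly to $\mathbf x_0$. Then $$\lim_{\lambda\to\infty}(q_\lambda\mu)(\mathbf x_0)=\gamma_{\mathbf x_0}$$ at every Lebesgue density point $\mathbf x_0$ of $\mu$. In particular, $\mu$ has a Lebesgue decomposition $d\mu=f\,dm+d\mu_s$ with $f\in L^1_{loc}(\mathbb R^n)$ and $\mu_s$ a complex Radon measure singular with respect to $m$, and for every such decomposition, $m$-almost every $\mathbf x_0$ is a Lebesgue density point of $\mu$ with $\gamma_{\mathbf x_0}=f(\mathbf x_0)$, so that $\lim_{\lambda\to\infty}(q_\lambda\mu)(\mathbf x_0)=f(\mathbf x_0)$ for $m$-almost every $\mathbf x_0$. -/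

import Mathlib

open MeasureTheory Filter Topology
open scoped NNReal ENNReal

noncomputable section

namespace MRAPointwise

/-- `ℝⁿ` with the Euclidean norm. -/
abbrev Rn (n : ℕ) : Type := EuclideanSpace ℝ (Fin n)

/-- The hypotheses on the growth function `M : [0,∞) → [0,∞)`: continuous, increasing (in the weak
sense, but not identically zero), superadditive, and `M (t + s) ≤ M (2t) + M (2s)`. -/
structure IsGrowthFunction (M : ℝ≥0 → ℝ≥0) : Prop where
  continuous : Continuous M
  monotone : Monotone M
  superadditive : ∀ t s, M t + M s ≤ M (t + s)
  add_le_two_mul : ∀ t s, M (t + s) ≤ M (2 * t) + M (2 * s)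
  exists_pos : ∃ t, 0 < M t

section ComplexRadon

variable {n : ℕ}

/-- A complex Radon measure on `ℝⁿ`, possibly of infinite total variation: a complex-valued set
function which is countably additive on the bounded Borel sets. The values at sets that are not
bounded Borel sets are irrelevant and never used. -/
structure ComplexRadonMeasure (n : ℕ) where
  toFun : Set (Rn n) → ℂ
  empty' : toFun ∅ = 0
  hasSum_iUnion' : ∀ B : ℕ → Set (Rn n), (∀ i, MeasurableSet (B i)) →
    Pairwise (Function.onFun Disjoint B) → Bornology.IsBounded (⋃ i, B i) →
    HasSum (fun i => toFun (B i)) (toFun (⋃ i, B i))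

/-- The finite complex measure `A ↦ μ (A ∩ K)`, for a bounded Borel set `K`. -/
def ComplexRadonMeasure.restrict (μ : ComplexRadonMeasure n) (K : Set (Rn n))
    (hK : MeasurableSet K) (hb : Bornology.IsBounded K) : ComplexMeasure (Rn n) := by
  classical
  exact
  { measureOf' := fun A => if MeasurableSet A then μ.toFun (A ∩ K) else 0
    empty' := by simp [μ.empty']
    not_measurable' := fun A hA => by simp [hA]
    m_iUnion' := fun B hB hd => by
      have h := μ.hasSum_iUnion' (fun i => B i ∩ K) (fun i => (hB i).inter hK)
        (fun i j hij => (hd hij).mono Set.inter_subset_left Set.inter_subset_left)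
        (hb.subset (Set.iUnion_subset fun i => Set.inter_subset_right))
      simpa [hB, MeasurableSet.iUnion hB, Set.iUnion_inter] using h }

/-- The spherical shells `{x : N ≤ |x| < N + 1}`; for `N = 0, 1, 2, …` they are a partition of `ℝⁿ`
into bounded Borel sets. -/
def shell (n : ℕ) (N : ℕ) : Set (Rn n) := {x | (N : ℝ) ≤ ‖x‖ ∧ ‖x‖ < N + 1}

theorem measurableSet_shell (N : ℕ) : MeasurableSet (shell n N) :=
  (measurableSet_le measurable_const measurable_norm).inter
    (measurableSet_lt measurable_norm measurable_const)

theorem isBounded_shell (N : ℕ) : Bornology.IsBounded (shell n N) :=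
  (Metric.isBounded_ball (x := (0 : Rn n)) (r := (N : ℝ) + 1)).subset fun x hx => by
    simpa using hx.2

/-- The part of `μ` in the shell `N`, as a finite complex measure. -/
def ComplexRadonMeasure.shellPart (μ : ComplexRadonMeasure n) (N : ℕ) : ComplexMeasure (Rn n) :=
  μ.restrict (shell n N) (measurableSet_shell N) (isBounded_shell N)

/-- The total variation measure `|μ|`: the sum of the total variations of the parts of `μ` in the
shells. -/
def ComplexRadonMeasure.variation (μ : ComplexRadonMeasure n) : Measure (Rn n) :=
  Measure.sum fun N => (μ.shellPart N).variation

/-- The integral `∫ g dμ`, for `g` integrable with respect to `|μ|`: the (then absolutely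
convergent) sum of the integrals over the shells. -/
def ComplexRadonMeasure.integral (μ : ComplexRadonMeasure n) (g : Rn n → ℂ) : ℂ :=
  ∑' N : ℕ, (μ.shellPart N).integral g (ContinuousLinearMap.mul ℝ ℂ)

/-- The sets `B 0, B 1, …` are Borel sets and shrink regularly to `x₀`. -/
def ShrinksRegularly (B : ℕ → Set (Rn n)) (x₀ : Rn n) : Prop :=
  (∀ ν, MeasurableSet (B ν)) ∧
    ∃ ε : ℕ → ℝ, (∀ ν, 0 < ε ν) ∧ Tendsto ε atTop (𝓝 0) ∧
      (∀ ν, B ν ⊆ Metric.ball x₀ (ε ν)) ∧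
      ∃ a : ℝ, 0 < a ∧ ∀ ν, a * ε ν ^ n ≤ (volume (B ν)).toReal

/-- `x₀` is a Lebesgue density point of `μ`, with density `γ`. -/
def IsLebesgueDensityPoint (μ : ComplexRadonMeasure n) (x₀ : Rn n) (γ : ℂ) : Prop :=
  ∀ B : ℕ → Set (Rn n), ShrinksRegularly B x₀ →
    Tendsto (fun ν => μ.toFun (B ν) / ((volume (B ν)).toReal : ℂ)) atTop (𝓝 γ)

/-- `dμ = f dm + dμₛ` is the Lebesgue decomposition of `μ` with respect to Lebesgue measure `m`. -/
structure IsLebesgueDecomposition (μ : ComplexRadonMeasure n) (f : Rn n → ℂ)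
    (μs : ComplexRadonMeasure n) : Prop where
  locallyIntegrable : LocallyIntegrable f volume
  singular : μs.variation ⟂ₘ volume
  eq_add : ∀ B : Set (Rn n), MeasurableSet B → Bornology.IsBounded B →
    μ.toFun B = (∫ x in B, f x) + μs.toFun B

end ComplexRadon

section Multiresolution

variable {n : ℕ}

/-- The point of `ℝⁿ` with the integer coordinates `m`. -/
def latticePoint (m : Fin n → ℤ) : Rn n := WithLp.toLp 2 fun i => (m i : ℝ)

/-- `L²(ℝⁿ)`, complex-valued. -/
abbrev L2 (n : ℕ) : Type := Lp ℂ 2 (volume : Measure (Rn n))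

/-- The integer translates of `φ` are an orthonormal basis of the closed subspace `V₀`. -/
def IsScalingFunction (V₀ : Submodule ℂ (L2 n)) (φ : Rn n → ℂ) : Prop :=
  ∃ h : ∀ m : Fin n → ℤ, MemLp (fun x => φ (x - latticePoint m)) 2 volume,
    Orthonormal ℂ (fun m => (h m).toLp) ∧
      (Submodule.span ℂ (Set.range fun m => (h m).toLp)).topologicalClosure = V₀

/-- Multiresolution analyses of `L²(ℝⁿ)`. -/
structure IsMRA (V : ℤ → Submodule ℂ (L2 n)) : Prop where
  isClosed : ∀ j, IsClosed (V j : Set (L2 n))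
  le_succ : ∀ j, V j ≤ V (j + 1)
  dilation : ∀ (j : ℤ) (f g : L2 n), (∀ᵐ x, g x = f ((2 : ℝ) • x)) → (f ∈ V j ↔ g ∈ V (j + 1))
  translation : ∀ (m : Fin n → ℤ) (f g : L2 n), (∀ᵐ x, g x = f (x - latticePoint m)) →
    (f ∈ V 0 ↔ g ∈ V 0)
  iInf_eq_bot : ⨅ j, V j = ⊥
  dense_iUnion : Dense (⋃ j, (V j : Set (L2 n)))
  exists_scaling : ∃ φ, IsScalingFunction (V 0) φ

/-- The term with index `m` of the series for the reproducing kernel of `V₀`. -/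
def kernelTerm (φ : Rn n → ℂ) (x y : Rn n) (m : Fin n → ℤ) : ℂ :=
  φ (x - latticePoint m) * starRingEnd ℂ (φ (y - latticePoint m))

/-- The reproducing kernel `q₀(x,y) = ∑ₘ φ(x - m) conj(φ(y - m))`. -/
def kernelZero (φ : Rn n → ℂ) (x y : Rn n) : ℂ := ∑' m : Fin n → ℤ, kernelTerm φ x y m

/-- The kernel `q_t(x,y) = 2^(n t) q₀(2^t x, 2^t y)`, for a real parameter `t`. -/
def kernel (φ : Rn n → ℂ) (t : ℝ) (x y : Rn n) : ℂ :=
  (((2 : ℝ) ^ ((n : ℝ) * t) : ℝ) : ℂ) * kernelZero φ (((2 : ℝ) ^ t) • x) (((2 : ℝ) ^ t) • y)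

/-- The multiresolution expansion `(q_t μ)(x) = ∫ q_t(x,y) dμ(y)` of a measure. -/
def expansion (φ : Rn n → ℂ) (μ : ComplexRadonMeasure n) (t : ℝ) (x : Rn n) : ℂ :=
  μ.integral fun y => kernel φ t x y

end Multiresolution

end MRAPointwise

end

open MRAPointwise

namespace MRAPointwise

/-! Fix a density point `x₀` with value `γ` and put `ρ = μ - γ m`. The kernels have integral one
(`integral_kernel_eq_one`), so `(q_t μ)(x₀) - γ = (q_t ρ)(x₀)`, and it suffices that `∫ |q_t(x₀, y)|
d|ρ|(y)` tends to zero. Three facts carry this.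

The kernel is localized. Superadditivity makes `M` grow at least linearly, so lattice sums of `φ`
converge, and the bound on `M (t + s)` turns the decay of both factors of the series into `|q₀(x,
y)| ≤ C exp (-M(l|x - y|))` for every `l` (`HasDecay.norm_kernelZero_le`).

The kernel reproduces constants. The function `c(x) = ∫ q₀(x, y) dy` is continuous and periodic
under the integer lattice. If `c ≠ 1` somewhere, then applying `q₀` to the indicator of a ball of
radius comparable to `2^j` makes an error bounded below on `2^(jn)` disjoint balls of one fixed
size, hence an `L²` error of at least a constant times `2^(jn/2)`. But this operator gives the best
approximation from `V₀`, and density of the union of the `V_j`, after rescaling, makes that error at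
most `ε 2^(jn/2)` for large `j` (`integral_kernelZero_eq_one`).

The total variation is small near `x₀`. Only the absolute value of the kernel is controlled, so
`|ρ|(B(x₀, r)) = o(r^n)` is needed, whereas the hypothesis concerns values of `μ` on regularly
shrinking sets. An arbitrary Borel subset of a ball is completed to sets of comparable volume, which
bounds `ρ` on all subsets (`IsLebesgueDensityPoint.isNegligibleAt`); the total variation is at most
four times the supremum of these values.

The integral against `|ρ|` is then split at a small ball. Inside, concentric balls of radii `(i +
1)/2^t` give a convergent sum times a small factor; outside, the decay of the kernel beats the
growth allowed by the weight. The almost everywhere statement follows from Lebesgue differentiation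
of `f` and of the singular part. -/

/-- The growth function as a function of a real variable. -/
noncomputable def growth (M : ℝ≥0 → ℝ≥0) (r : ℝ) : ℝ := M r.toNNReal

/-! ### Elementary properties of the growth function. -/

section Growth

variable {M : ℝ≥0 → ℝ≥0}

lemma growth_nonneg (r : ℝ) : 0 ≤ growth M r := NNReal.coe_nonneg _

lemma growth_norm {E : Type*} [SeminormedAddCommGroup E] (k : ℝ≥0) (x : E) :
    growth M (k * ‖x‖) = M (k * ‖x‖₊) := by
  unfold growth
  congr 2
  ext
  exact Real.coe_toNNReal _ (mul_nonneg k.2 (norm_nonneg x))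

lemma growth_mono (hM : IsGrowthFunction M) {r s : ℝ} (h : r ≤ s) : growth M r ≤ growth M s :=
  NNReal.coe_le_coe.2 (hM.monotone (Real.toNNReal_le_toNNReal h))

lemma growth_measurable (hM : IsGrowthFunction M) : Measurable (growth M) :=
  Monotone.measurable fun _ _ h => growth_mono hM h

lemma growth_add_le (hM : IsGrowthFunction M) {r s : ℝ} (hr : 0 ≤ r) (hs : 0 ≤ s) :
    growth M r + growth M s ≤ growth M (r + s) := by
  unfold growth
  rw [Real.toNNReal_add hr hs]
  exact_mod_cast hM.superadditive _ _

lemma growth_le_add (hM : IsGrowthFunction M) {r s : ℝ} (hr : 0 ≤ r) (hs : 0 ≤ s) :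
    growth M (r + s) ≤ growth M (2 * r) + growth M (2 * s) := by
  unfold growth
  rw [Real.toNNReal_add hr hs, Real.toNNReal_mul zero_le_two, Real.toNNReal_mul zero_le_two,
    show (2 : ℝ).toNNReal = 2 by simp]
  exact_mod_cast hM.add_le_two_mul _ _

/-- A superadditive growth function grows at least linearly. -/
lemma exists_linear_le_growth (hM : IsGrowthFunction M) :
    ∃ a > 0, ∃ b : ℝ, ∀ r, a * r - b ≤ growth M r := by
  obtain ⟨t, ht⟩ := hM.exists_pos
  have h0 : M 0 = 0 := by simpa using hM.superadditive 0 0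
  have ht0 : (0 : ℝ) < t := by
    rcases eq_or_ne t 0 with rfl | h
    · simp [h0] at ht
    · exact_mod_cast pos_iff_ne_zero.2 h
  have hN : ∀ N : ℕ, N * (M t : ℝ) ≤ growth M (N * t) := by
    intro N
    induction N with
    | zero => simpa using growth_nonneg _
    | succ N ih =>
      have h1 := growth_add_le hM (r := N * t) (s := t) (by positivity) ht0.le
      have h2 : growth M t = M t := by simp [growth]
      push_cast
      rw [add_mul, add_mul, one_mul, one_mul]
      linarith
  have hMt : (0 : ℝ) < M t := by exact_mod_cast ht
  -- The chord slope at `t`; the constant `M t` pays for rounding `r / t` down to an integer.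
  refine ⟨M t / t, by positivity, M t, fun r => ?_⟩
  rcases le_or_gt r 0 with hr | hr
  · have : (M t : ℝ) / t * r ≤ 0 := mul_nonpos_of_nonneg_of_nonpos (by positivity) hr
    have := growth_nonneg (M := M) r
    linarith
  · have h1 := Nat.floor_le (a := r / t) (by positivity)
    have h2 := Nat.lt_floor_add_one (r / t)
    have h3 : growth M (⌊r / t⌋₊ * t) ≤ growth M r := growth_mono hM ((le_div_iff₀ ht0).1 h1)
    have h4 : M t / t * r = (r / t) * (M t : ℝ) := by field_simp
    have h5 := hN ⌊r / t⌋₊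
    rw [h4]
    nlinarith

/-- Transfers a weight centred at the origin to one centred at `x`, at the cost of doubling `k`. -/
lemma growth_mul_norm_le (hM : IsGrowthFunction M) {E : Type*} [SeminormedAddCommGroup E] {k : ℝ}
    (hk : 0 ≤ k) (x y : E) :
    growth M (k * ‖y‖) ≤ growth M (2 * k * ‖y - x‖) + growth M (2 * k * ‖x‖) := by
  have h1 : ‖y‖ ≤ ‖y - x‖ + ‖x‖ := by simpa using norm_add_le (y - x) x
  calc growth M (k * ‖y‖) ≤ growth M (k * ‖y - x‖ + k * ‖x‖) :=
        growth_mono hM (by rw [← mul_add]; gcongr)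
    _ ≤ _ := growth_le_add hM (by positivity) (by positivity)
    _ = _ := by simp only [mul_assoc]

end Growth

/-! ### Exponential sums over the integer lattice. -/

section Lattice

variable {n : ℕ}

lemma integrable_exp_neg_mul_norm {a : ℝ} (ha : 0 < a) :
    Integrable (fun y : Rn n => Real.exp (-(a * ‖y‖))) volume := by
  have h := (integrable_one_add_norm (E := Rn n) (μ := volume) (r := ((n + 1 : ℕ) : ℝ)) (by
    simp))
  obtain ⟨C, hC⟩ : ∃ C : ℝ, ∀ r : ℝ, 0 ≤ r → (1 + r) ^ (n + 1) * Real.exp (-(a * r)) ≤ C := by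
    -- The constant comes from `u ^ N / N! ≤ exp u` with `u = a (1 + r)` and `N = n + 1`.
    refine ⟨((n + 1).factorial : ℝ) * Real.exp a / a ^ (n + 1), fun r hr => ?_⟩
    have h1 := Real.pow_div_factorial_le_exp (a * (1 + r)) (by positivity) (n + 1)
    rw [div_le_iff₀ (by positivity)] at h1
    rw [le_div_iff₀ (by positivity)]
    have h2 : Real.exp (a * (1 + r)) = Real.exp a * Real.exp (a * r) := by
      rw [← Real.exp_add]; ring_nf
    have h3 : Real.exp (a * r) * Real.exp (-(a * r)) = 1 := by
      rw [← Real.exp_add]; simp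
    calc (1 + r) ^ (n + 1) * Real.exp (-(a * r)) * a ^ (n + 1)
        = (a * (1 + r)) ^ (n + 1) * Real.exp (-(a * r)) := by rw [mul_pow]; ring
      _ ≤ (Real.exp (a * (1 + r)) * (n + 1).factorial) * Real.exp (-(a * r)) := by gcongr
      _ = (n + 1).factorial * Real.exp a * (Real.exp (a * r) * Real.exp (-(a * r))) := by
        rw [h2]; ring
      _ = _ := by rw [h3, mul_one]
  refine (h.const_mul C).mono' (by fun_prop) (ae_of_all _ fun y => ?_)
  rw [Real.norm_eq_abs, abs_of_pos (Real.exp_pos _), Real.rpow_neg (by positivity),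
    Real.rpow_natCast, ← div_eq_mul_inv, le_div_iff₀ (by positivity), mul_comm]
  exact hC _ (norm_nonneg _)

lemma latticePoint_sub (m m' : Fin n → ℤ) :
    latticePoint (m - m') = latticePoint m - latticePoint m' := by
  ext i; simp [latticePoint]

lemma latticePoint_add (m m' : Fin n → ℤ) :
    latticePoint (m + m') = latticePoint m + latticePoint m' := by
  ext i; simp [latticePoint]

lemma one_le_norm_latticePoint {m : Fin n → ℤ} (hm : m ≠ 0) : 1 ≤ ‖latticePoint m‖ := by
  obtain ⟨i, hi⟩ := Function.ne_iff.1 hm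
  refine le_trans ?_ (PiLp.norm_apply_le (latticePoint m) i)
  simp only [latticePoint, Real.norm_eq_abs]
  exact_mod_cast Int.one_le_abs hi

lemma disjoint_ball_latticePoint {r : ℝ} (hr : r ≤ 1 / 2) (x : Rn n) :
    Pairwise (Function.onFun Disjoint fun m => Metric.ball (x + latticePoint m) r) := by
  intro m m' h
  refine Metric.ball_disjoint_ball ?_
  have := one_le_norm_latticePoint (sub_ne_zero.2 h)
  rw [dist_eq_norm, add_sub_add_left_eq_sub, ← latticePoint_sub]
  linarith

/-- Each term is compared with an integral over the ball of radius `1/2` at its lattice point. These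
balls are disjoint, so the sum is at most `exp (a/2)` times the full integral, divided by the volume
of one ball. Translation invariance makes the bound uniform in `x`. -/
lemma exists_tsum_exp_le {a : ℝ} (ha : 0 < a) : ∃ S : ℝ, ∀ x : Rn n,
    Summable (fun m : Fin n → ℤ => Real.exp (-(a * ‖x - latticePoint m‖))) ∧
      ∑' m : Fin n → ℤ, Real.exp (-(a * ‖x - latticePoint m‖)) ≤ S := by
  set I := ∫⁻ y : Rn n, ENNReal.ofReal (Real.exp (-(a * ‖y‖))) with hI
  have hIfin : I ≠ ∞ := by
    have := (integrable_exp_neg_mul_norm (n := n) ha).lintegral_lt_top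
    exact this.ne
  set v := volume (Metric.ball (0 : Rn n) (1 / 2)) with hv
  have hv0 : v ≠ 0 := (Metric.measure_ball_pos _ _ (by norm_num)).ne'
  have hvfin : v ≠ ∞ := measure_ball_lt_top.ne
  have key : ∀ x : Rn n, ∑' m : Fin n → ℤ, ENNReal.ofReal (Real.exp (-(a * ‖x - latticePoint m‖)))
      ≤ ENNReal.ofReal (Real.exp (a / 2)) * I / v := by
    intro x
    rw [ENNReal.le_div_iff_mul_le (Or.inl hv0) (Or.inl hvfin), ← ENNReal.tsum_mul_right]
    have hdisj := disjoint_ball_latticePoint le_rfl (0 : Rn n)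
    calc ∑' m : Fin n → ℤ, ENNReal.ofReal (Real.exp (-(a * ‖x - latticePoint m‖))) * v
        ≤ ∑' m : Fin n → ℤ, ∫⁻ y in Metric.ball (0 + latticePoint m) (1 / 2),
            ENNReal.ofReal (Real.exp (a / 2)) * ENNReal.ofReal (Real.exp (-(a * ‖x - y‖))) := by
          refine ENNReal.tsum_le_tsum fun m => ?_
          have : v = volume (Metric.ball (0 + latticePoint m) (1 / 2)) := by
            exact (Measure.addHaar_ball_center _ _ _).symm
          rw [this, ← setLIntegral_const]
          refine setLIntegral_mono' measurableSet_ball fun y hy => ?_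
          rw [← ENNReal.ofReal_mul (Real.exp_nonneg _), ← Real.exp_add]
          refine ENNReal.ofReal_le_ofReal (Real.exp_le_exp.2 ?_)
          have h1 : ‖x - y‖ ≤ ‖x - latticePoint m‖ + ‖y - latticePoint m‖ := by
            have := norm_sub_le (x - latticePoint m) (y - latticePoint m)
            rwa [sub_sub_sub_cancel_right] at this
          have h2 : ‖y - latticePoint m‖ ≤ 1 / 2 := by
            rw [zero_add, mem_ball_iff_norm] at hy; exact hy.le
          nlinarith
      _ = ∫⁻ y in ⋃ m : Fin n → ℤ, Metric.ball (0 + latticePoint m) (1 / 2),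
            ENNReal.ofReal (Real.exp (a / 2)) * ENNReal.ofReal (Real.exp (-(a * ‖x - y‖))) :=
          (lintegral_iUnion (fun _ => measurableSet_ball) hdisj _).symm
      _ ≤ ∫⁻ y, ENNReal.ofReal (Real.exp (a / 2)) * ENNReal.ofReal (Real.exp (-(a * ‖x - y‖))) :=
          setLIntegral_le_lintegral _ _
      _ = ENNReal.ofReal (Real.exp (a / 2)) * I := by
          rw [lintegral_const_mul _ (by fun_prop), hI,
            lintegral_sub_left_eq_self (fun y => ENNReal.ofReal (Real.exp (-(a * ‖y‖)))) x]
  have hfin : ENNReal.ofReal (Real.exp (a / 2)) * I / v ≠ ∞ :=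
    (ENNReal.div_lt_top (ENNReal.mul_ne_top ENNReal.ofReal_ne_top hIfin) hv0).ne
  refine ⟨(ENNReal.ofReal (Real.exp (a / 2)) * I / v).toReal, fun x => ?_⟩
  have h1 := ENNReal.summable_toReal (ne_top_of_le_ne_top hfin (key x))
  have h2 : ∀ m : Fin n → ℤ, (ENNReal.ofReal (Real.exp (-(a * ‖x - latticePoint m‖)))).toReal
      = Real.exp (-(a * ‖x - latticePoint m‖)) := fun m =>
    ENNReal.toReal_ofReal (Real.exp_nonneg _)
  refine ⟨by simpa only [h2] using h1, ?_⟩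
  have h3 := ENNReal.toReal_mono hfin (key x)
  rw [ENNReal.tsum_toReal_eq (fun _ => ENNReal.ofReal_ne_top)] at h3
  simpa only [h2] using h3

end Lattice

/-! ### Decay of the scaling function and of the kernel. -/

section Kernel

variable {n : ℕ} {M : ℝ≥0 → ℝ≥0} {φ : Rn n → ℂ}

/-- `φ` decays faster than `exp (-M(l|x|))` for every `l`. -/
def HasDecay (M : ℝ≥0 → ℝ≥0) (φ : Rn n → ℂ) : Prop :=
  ∀ l : ℕ, ∃ C : ℝ, 0 ≤ C ∧ ∀ x, ‖φ x‖ ≤ C * Real.exp (-growth M (l * ‖x‖))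

/-- A continuous function vanishing at infinity is bounded. -/
lemma hasDecay_of_tendsto (hM : IsGrowthFunction M) (hφ : Continuous φ)
    (h : ∀ l : ℕ, Tendsto (fun x => Real.exp (M ((l : ℝ≥0) * ‖x‖₊)) • φ x)
      (cocompact (Rn n)) (𝓝 0)) : HasDecay M φ := by
  intro l
  have hc : Continuous fun x : Rn n => Real.exp (M ((l : ℝ≥0) * ‖x‖₊)) • φ x := by
    have := hM.continuous
    fun_prop
  let g : ZeroAtInftyContinuousMap (Rn n) ℂ := ⟨⟨_, hc⟩, h l⟩
  refine ⟨‖g.toBCF‖, norm_nonneg _, fun x => ?_⟩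
  have h1 : ‖Real.exp (M ((l : ℝ≥0) * ‖x‖₊)) • φ x‖ ≤ ‖g.toBCF‖ := g.toBCF.norm_coe_le_norm x
  rw [norm_smul, Real.norm_eq_abs, abs_of_pos (Real.exp_pos _)] at h1
  have h2 := growth_norm (M := M) (l : ℝ≥0) x
  rw [NNReal.coe_natCast] at h2
  rw [h2, Real.exp_neg, ← div_eq_mul_inv, le_div_iff₀ (Real.exp_pos _), mul_comm]
  exact h1

lemma HasDecay.exists_exp_bound (hM : IsGrowthFunction M) (hφ : HasDecay M φ) :
    ∃ a > 0, ∃ C : ℝ, 0 ≤ C ∧ ∀ x, ‖φ x‖ ≤ C * Real.exp (-(a * ‖x‖)) := by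
  obtain ⟨a, ha, b, hab⟩ := exists_linear_le_growth hM
  obtain ⟨C, hC, h⟩ := hφ 1
  refine ⟨a, ha, C * Real.exp b, by positivity, fun x => (h x).trans ?_⟩
  rw [mul_assoc, ← Real.exp_add]
  gcongr
  have := hab ‖x‖
  simp only [Nat.cast_one, one_mul]
  linarith

/-- The terms of the kernel series are absolutely summable, with an off-diagonal decay. -/
lemma HasDecay.kernelTerm_bound (hM : IsGrowthFunction M) (hφ : HasDecay M φ) (l : ℕ) :
    ∃ C : ℝ, 0 ≤ C ∧ ∀ x y, Summable (fun m => ‖kernelTerm φ x y m‖) ∧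
      ∑' m, ‖kernelTerm φ x y m‖ ≤ C * Real.exp (-growth M (l * ‖x - y‖)) := by
  obtain ⟨a, ha, b, hab⟩ := exists_linear_le_growth hM
  obtain ⟨S, hS⟩ := exists_tsum_exp_le (n := n) ha
  -- The part `2l` is consumed in splitting `M (l|x - y|)` between the two factors; the extra `1`
  -- leaves a factor `exp (-M |x - m|)`, summable over the lattice.
  obtain ⟨C, hC, h⟩ := hφ (2 * l + 1)
  have hS0 : 0 ≤ S := (tsum_nonneg fun m => (Real.exp_nonneg _)).trans (hS 0).2
  have key : ∀ x y m, ‖kernelTerm φ x y m‖ ≤ C * C * Real.exp b *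
      Real.exp (-growth M (l * ‖x - y‖)) * Real.exp (-(a * ‖x - latticePoint m‖)) := by
    intro x y m
    set u := ‖x - latticePoint m‖ with hu
    set v := ‖y - latticePoint m‖ with hv
    have hu0 : 0 ≤ u := norm_nonneg _
    have hv0 : 0 ≤ v := norm_nonneg _
    have h1 : ‖x - y‖ ≤ u + v := by
      have := norm_sub_le (x - latticePoint m) (y - latticePoint m)
      rwa [sub_sub_sub_cancel_right] at this
    have h2 : growth M (l * ‖x - y‖) ≤ growth M (2 * (l * u)) + growth M (2 * (l * v)) :=
      (growth_mono hM (by rw [← mul_add]; gcongr)).trans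
        (growth_le_add hM (by positivity) (by positivity))
    have h3 : growth M (2 * (l * u)) + growth M u ≤ growth M ((2 * l + 1 : ℕ) * u) := by
      have := growth_add_le hM (r := 2 * (l * u)) (s := u) (by positivity) hu0
      convert this using 2; push_cast; ring
    have h4 : growth M (2 * (l * v)) ≤ growth M ((2 * l + 1 : ℕ) * v) :=
      growth_mono hM (by push_cast; nlinarith)
    have h5 := hab u
    calc ‖kernelTerm φ x y m‖ = ‖φ (x - latticePoint m)‖ * ‖φ (y - latticePoint m)‖ := by
          simp [kernelTerm]
      _ ≤ (C * Real.exp (-growth M ((2 * l + 1 : ℕ) * u))) *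
            (C * Real.exp (-growth M ((2 * l + 1 : ℕ) * v))) :=
          mul_le_mul (h _) (h _) (norm_nonneg _) (by positivity)
      _ = C * C * Real.exp (-growth M ((2 * l + 1 : ℕ) * u) +
            -growth M ((2 * l + 1 : ℕ) * v)) := by rw [Real.exp_add]; ring
      _ ≤ C * C * Real.exp (b + -growth M (l * ‖x - y‖) + -(a * u)) := by
          refine mul_le_mul_of_nonneg_left (Real.exp_le_exp.2 ?_) (by positivity)
          linarith
      _ = _ := by rw [Real.exp_add, Real.exp_add]; ring
  refine ⟨C * C * Real.exp b * S, by positivity, fun x y => ?_⟩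
  have hs := (hS x).1.mul_left (C * C * Real.exp b * Real.exp (-growth M (l * ‖x - y‖)))
  have hs' : Summable fun m => ‖kernelTerm φ x y m‖ :=
    Summable.of_nonneg_of_le (fun _ => norm_nonneg _) (key x y) hs
  refine ⟨hs', (hs'.tsum_le_tsum (key x y) hs).trans ?_⟩
  rw [tsum_mul_left]
  calc _ ≤ C * C * Real.exp b * Real.exp (-growth M (l * ‖x - y‖)) * S := by
        gcongr; exact (hS x).2
    _ = _ := by ring

lemma HasDecay.summable_norm_kernelTerm (hM : IsGrowthFunction M) (hφ : HasDecay M φ) (x y : Rn n) :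
    Summable (fun m => ‖kernelTerm φ x y m‖) := by
  obtain ⟨C, -, h⟩ := hφ.kernelTerm_bound hM 0
  exact (h x y).1

lemma HasDecay.norm_kernelZero_le (hM : IsGrowthFunction M) (hφ : HasDecay M φ) (l : ℕ) :
    ∃ C : ℝ, 0 ≤ C ∧ ∀ x y, ‖kernelZero φ x y‖ ≤ C * Real.exp (-growth M (l * ‖x - y‖)) := by
  obtain ⟨C, hC, h⟩ := hφ.kernelTerm_bound hM l
  exact ⟨C, hC, fun x y => (norm_tsum_le_tsum_norm (h x y).1).trans (h x y).2⟩

lemma HasDecay.norm_kernel_le (hM : IsGrowthFunction M) (hφ : HasDecay M φ) (l : ℕ) :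
    ∃ C : ℝ, 0 ≤ C ∧ ∀ t x y, ‖kernel φ t x y‖ ≤
      C * ((2 : ℝ) ^ t) ^ n * Real.exp (-growth M (l * 2 ^ t * ‖x - y‖)) := by
  obtain ⟨C, hC, h⟩ := hφ.norm_kernelZero_le hM l
  refine ⟨C, hC, fun t x y => ?_⟩
  have h2 : (0 : ℝ) < 2 ^ t := Real.rpow_pos_of_pos two_pos t
  rw [kernel, norm_mul, Complex.norm_real, Real.norm_eq_abs,
    abs_of_pos (Real.rpow_pos_of_pos two_pos _), mul_comm (n : ℝ), Real.rpow_mul two_pos.le,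
    Real.rpow_natCast]
  have h1 := h ((2 : ℝ) ^ t • x) ((2 : ℝ) ^ t • y)
  rw [← smul_sub, norm_smul, Real.norm_eq_abs, abs_of_pos h2, ← mul_assoc] at h1
  calc _ ≤ ((2 : ℝ) ^ t) ^ n * (C * Real.exp (-growth M (l * 2 ^ t * ‖x - y‖))) := by gcongr
    _ = _ := by ring

lemma measurable_kernelTerm (hφ : Continuous φ) (x : Rn n) (m : Fin n → ℤ) :
    Measurable fun y => kernelTerm φ x y m := by
  unfold kernelTerm
  have : Continuous fun y => φ (x - latticePoint m) * starRingEnd ℂ (φ (y - latticePoint m)) :=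
    continuous_const.mul (Complex.continuous_conj.comp (hφ.comp (continuous_id.sub continuous_const)))
  exact this.measurable

lemma measurable_kernelZero (hφ : Continuous φ) (x : Rn n) : Measurable (kernelZero φ x) := by
  unfold kernelZero
  exact Measurable.tsum fun m => measurable_kernelTerm hφ x m

lemma measurable_kernel (hφ : Continuous φ) (t : ℝ) (x : Rn n) : Measurable (kernel φ t x) := by
  unfold kernel
  exact ((measurable_kernelZero hφ _).comp (measurable_const_smul _)).const_mul _

end Kernel

/-! ### Best approximation by partial Fourier sums. -/

section BestApproximation

open scoped InnerProductSpace

variable {ι E : Type*} [NormedAddCommGroup E] [InnerProductSpace ℂ E]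

/-- Partial Fourier sums are the best approximations from the span of the frequencies used. -/
lemma norm_sub_sum_inner_le {e : ι → E} (he : Orthonormal ℂ e) (f : E) (s : Finset ι)
    (c : ι → ℂ) : ‖f - ∑ i ∈ s, ⟪e i, f⟫_ℂ • e i‖ ≤ ‖f - ∑ i ∈ s, c i • e i‖ := by
  set S := ∑ i ∈ s, ⟪e i, f⟫_ℂ • e i with hS
  have h1 : f - ∑ i ∈ s, c i • e i = (∑ i ∈ s, (⟪e i, f⟫_ℂ - c i) • e i) + (f - S) := by
    simp only [sub_smul, Finset.sum_sub_distrib, ← hS]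
    abel
  have h2 : ∀ i ∈ s, ⟪e i, f - S⟫_ℂ = 0 := by
    intro i hi
    rw [inner_sub_right, hS, he.inner_right_sum _ hi, sub_self]
  have h3 : ⟪∑ i ∈ s, (⟪e i, f⟫_ℂ - c i) • e i, f - S⟫_ℂ = 0 := by
    rw [sum_inner]
    refine Finset.sum_eq_zero fun i hi => ?_
    rw [inner_smul_left, h2 i hi, mul_zero]
  have h4 := norm_add_sq_eq_norm_sq_add_norm_sq_of_inner_eq_zero _ _ h3
  rw [← h1] at h4
  refine le_of_sq_le_sq ?_ (norm_nonneg _)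
  nlinarith [mul_self_nonneg ‖∑ i ∈ s, (⟪e i, f⟫_ℂ - c i) • e i‖]

/-- Once the finite index set contains the support of a finite combination near `v`, the partial sum
does at least as well as that combination. No completeness and no limit of the Fourier series is
needed. -/
lemma eventually_norm_sub_sum_inner_le {e : ι → E} (he : Orthonormal ℂ e) (f v : E)
    (hv : v ∈ (Submodule.span ℂ (Set.range e)).topologicalClosure) {ε : ℝ} (hε : 0 < ε) :
    ∀ᶠ s : Finset ι in atTop, ‖f - ∑ i ∈ s, ⟪e i, f⟫_ℂ • e i‖ ≤ ‖f - v‖ + ε := by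
  classical
  obtain ⟨w, hw, hvw⟩ := Metric.mem_closure_iff.1 hv ε hε
  obtain ⟨c, rfl⟩ := Finsupp.mem_span_range_iff_exists_finsupp.1 hw
  filter_upwards [eventually_ge_atTop c.support] with s hs
  have h1 : (c.sum fun i a => a • e i) = ∑ i ∈ s, c i • e i :=
    Finsupp.sum_of_support_subset _ hs _ (by simp)
  rw [h1, dist_eq_norm] at hvw
  calc _ ≤ ‖f - ∑ i ∈ s, c i • e i‖ := norm_sub_sum_inner_le he f s c
    _ = ‖(f - v) + (v - ∑ i ∈ s, c i • e i)‖ := by rw [sub_add_sub_cancel]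
    _ ≤ _ := (norm_add_le _ _).trans (by gcongr)

end BestApproximation

/-! ### Dilations on `L²` and rescaled approximation from `V₀`. -/

section Dilation

variable {n : ℕ}

lemma quasiMeasurePreserving_const_smul {r : ℝ} (hr : r ≠ 0) :
    Measure.QuasiMeasurePreserving (fun x : Rn n => r • x) volume volume := by
  refine ⟨measurable_const_smul r, ?_⟩
  rw [Measure.map_addHaar_smul _ hr]
  exact Measure.smul_absolutelyContinuous

lemma eLpNorm_comp_const_smul {r : ℝ} (hr : r ≠ 0) {g : Rn n → ℂ}
    (hg : AEStronglyMeasurable g volume) :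
    eLpNorm (fun x => g (r • x)) 2 volume =
      ENNReal.ofReal |(r ^ n)⁻¹| ^ (1 / 2 : ℝ) * eLpNorm g 2 volume := by
  have h1 := Measure.map_addHaar_smul (volume : Measure (Rn n)) hr
  rw [finrank_euclideanSpace_fin] at h1
  have h2 : AEStronglyMeasurable g (Measure.map (r • ·) (volume : Measure (Rn n))) := by
    rw [h1]; exact hg.smul_measure _
  have h3 := eLpNorm_map_measure (p := 2) h2 (measurable_const_smul r).aemeasurable
  rw [show (fun x => g (r • x)) = g ∘ (r • ·) from rfl, ← h3, h1,
    eLpNorm_smul_measure_of_ne_top (by simp)]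
  simp

lemma memLp_comp_const_smul {r : ℝ} (hr : r ≠ 0) {g : Rn n → ℂ} (hg : MemLp g 2 volume) :
    MemLp (fun x => g (r • x)) 2 volume := by
  refine ⟨hg.1.comp_quasiMeasurePreserving (quasiMeasurePreserving_const_smul hr), ?_⟩
  rw [eLpNorm_comp_const_smul hr hg.1]
  exact ENNReal.mul_lt_top (ENNReal.rpow_lt_top_of_nonneg (by norm_num) ENNReal.ofReal_ne_top) hg.2

/-- Iterates the dilation axiom, one factor `1/2` at a time. -/
lemma IsMRA.exists_dilate_mem {V : ℤ → Submodule ℂ (L2 n)} (hV : IsMRA V) (j : ℕ) :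
    ∀ h ∈ V j, ∃ v ∈ V 0, ∀ᵐ x, v x = h (((1 / 2 : ℝ) ^ j) • x) := by
  induction j with
  | zero => exact fun h hh => ⟨h, hh, by simp⟩
  | succ j ih =>
    intro h hh
    have hm := memLp_comp_const_smul (r := 1 / 2) (by norm_num) (Lp.memLp h)
    have hf := hm.coeFn_toLp
    have hmem : hm.toLp ∈ V j := by
      refine (hV.dilation j (hm.toLp) h ?_).2 (by exact_mod_cast hh)
      filter_upwards [(quasiMeasurePreserving_const_smul (n := n) two_ne_zero).ae_eq_comp hf]
        with x hx
      simp only [Function.comp_apply] at hx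
      rw [hx, smul_smul]
      norm_num
    obtain ⟨v, hv, hvx⟩ := ih _ hmem
    refine ⟨v, hv, ?_⟩
    filter_upwards [hvx, (quasiMeasurePreserving_const_smul (n := n) (r := (1 / 2 : ℝ) ^ j)
      (by positivity)).ae_eq_comp hf] with x h1 h2
    simp only [Function.comp_apply] at h2
    rw [h1, h2, smul_smul, pow_succ']

/-- Approximate `F` within `ε` from some `V_i`, hence from every later `V_j`, and dilate by
`2^(-j)`. The approximant lands in `V₀` and the error is multiplied by exactly `2^(jn/2)`. -/
lemma IsMRA.exists_near {V : ℤ → Submodule ℂ (L2 n)} (hV : IsMRA V) {F : Rn n → ℂ}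
    (hF : MemLp F 2 volume) {ε : ℝ≥0∞} (hε : 0 < ε) :
    ∃ J : ℕ, ∀ j ≥ J, ∃ v ∈ V 0, eLpNorm (fun x => F (((1 / 2 : ℝ) ^ j) • x) - v x) 2 volume ≤
      ENNReal.ofReal ((2 : ℝ) ^ (j * n)) ^ (1 / 2 : ℝ) * ε := by
  have hmono : ∀ (i : ℤ) (k : ℕ), V i ≤ V (i + k) := by
    intro i k
    induction k with
    | zero => simp
    | succ k ih => exact ih.trans (by rw [Nat.cast_succ, ← add_assoc]; exact hV.le_succ _)
  obtain ⟨h, hhU, hh⟩ := EMetric.mem_closure_iff.1 (hV.dense_iUnion (hF.toLp)) ε hε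
  obtain ⟨i, hi⟩ := Set.mem_iUnion.1 hhU
  -- The level `i` may be negative, in which case every natural number `j` works.
  refine ⟨i.toNat, fun j hj => ?_⟩
  have hij : h ∈ V j := by
    have := hmono i (j - i).toNat hi
    rwa [show i + ((j - i).toNat : ℤ) = j by omega] at this
  obtain ⟨v, hv, hvx⟩ := hV.exists_dilate_mem j h hij
  refine ⟨v, hv, ?_⟩
  have h1 : (fun x => F (((1 / 2 : ℝ) ^ j) • x) - v x) =ᵐ[volume]
      fun x => (fun y => F y - h y) (((1 / 2 : ℝ) ^ j) • x) := by
    filter_upwards [hvx] with x hx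
    rw [hx]
  have h2 : eLpNorm (fun y => F y - h y) 2 volume ≤ ε := by
    rw [Lp.edist_def] at hh
    refine le_trans (eLpNorm_congr_ae ?_).le hh.le
    filter_upwards [hF.coeFn_toLp] with x hx
    simp [hx]
  rw [eLpNorm_congr_ae h1, eLpNorm_comp_const_smul (g := fun y => F y - h y) (by positivity)
    (hF.1.sub (Lp.aestronglyMeasurable h))]
  have h3 : |((((1 / 2 : ℝ) ^ j) ^ n)⁻¹)| = 2 ^ (j * n) := by
    rw [abs_of_pos (by positivity), ← pow_mul, one_div, inv_pow, inv_inv]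
  rw [h3]
  gcongr

end Dilation

/-! ### The kernel has integral one. -/

section ConstantReproduction

variable {n : ℕ} {M : ℝ≥0 → ℝ≥0} {φ : Rn n → ℂ}

lemma HasDecay.integrable (hM : IsGrowthFunction M) (hφ : HasDecay M φ) (hc : Continuous φ) :
    Integrable φ := by
  obtain ⟨a, ha, C, hC, h⟩ := hφ.exists_exp_bound hM
  exact ((integrable_exp_neg_mul_norm ha).const_mul C).mono' hc.aestronglyMeasurable
    (ae_of_all _ h)

lemma HasDecay.summable_norm_translate (hM : IsGrowthFunction M) (hφ : HasDecay M φ) (x : Rn n) :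
    Summable fun m : Fin n → ℤ => ‖φ (x - latticePoint m)‖ := by
  obtain ⟨a, ha, C, hC, h⟩ := hφ.exists_exp_bound hM
  obtain ⟨S, hS⟩ := exists_tsum_exp_le (n := n) ha
  exact Summable.of_nonneg_of_le (fun _ => norm_nonneg _) (fun m => h _) ((hS x).1.mul_left C)

/-- The series is dominated uniformly on unit balls; moving `x` by less than one costs a factor `exp
a`. -/
lemma HasDecay.continuous_tsum_translate (hM : IsGrowthFunction M) (hφ : HasDecay M φ)
    (hc : Continuous φ) : Continuous fun x => ∑' m : Fin n → ℤ, φ (x - latticePoint m) := by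
  obtain ⟨a, ha, C, hC, h⟩ := hφ.exists_exp_bound hM
  obtain ⟨S, hS⟩ := exists_tsum_exp_le (n := n) ha
  refine continuous_iff_continuousAt.2 fun x₀ => ?_
  refine ContinuousOn.continuousAt (s := Metric.ball x₀ 1) ?_ (Metric.ball_mem_nhds _ one_pos)
  refine continuousOn_tsum (fun m => (hc.comp (continuous_id.sub continuous_const)).continuousOn)
    ((hS x₀).1.mul_left (C * Real.exp a)) fun m x hx => (h _).trans ?_
  rw [mul_assoc, ← Real.exp_add]
  refine mul_le_mul_of_nonneg_left (Real.exp_le_exp.2 ?_) hC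
  have h1 : ‖x₀ - latticePoint m‖ ≤ ‖x - latticePoint m‖ + ‖x - x₀‖ := by
    have := norm_sub_le (x - latticePoint m) (x - x₀)
    rwa [sub_sub_sub_cancel_left] at this
  have h2 : ‖x - x₀‖ < 1 := mem_ball_iff_norm.1 hx
  nlinarith

lemma tsum_translate_periodic (x : Rn n) (p : Fin n → ℤ) :
    ∑' m : Fin n → ℤ, φ (x - latticePoint p - latticePoint m) =
      ∑' m : Fin n → ℤ, φ (x - latticePoint m) := by
  rw [← (Equiv.addLeft p).tsum_eq (fun m => φ (x - latticePoint m))]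
  simp [latticePoint_add, sub_sub]

/-- Termwise integration of the kernel over a set. -/
lemma HasDecay.hasSum_setIntegral_kernelZero (hM : IsGrowthFunction M) (hφ : HasDecay M φ)
    (hc : Continuous φ) (K : Set (Rn n)) (x : Rn n) :
    HasSum (fun m => φ (x - latticePoint m) *
      ∫ y in K, starRingEnd ℂ (φ (y - latticePoint m))) (∫ y in K, kernelZero φ x y) := by
  have hint : ∀ m : Fin n → ℤ, Integrable fun y => φ (y - latticePoint m) := fun m =>
    (hφ.integrable hM hc).comp_sub_right _
  have hint' : ∀ m : Fin n → ℤ, Integrable fun y => kernelTerm φ x y m := fun m =>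
    ((Complex.conjCLE.integrable_comp_iff).2 (hint m)).const_mul _
  have h := hasSum_integral_of_summable_integral_norm (μ := volume.restrict K)
    (F := fun m y => kernelTerm φ x y m) (fun m => (hint' m).integrableOn) ?_
  · simpa only [kernelTerm, integral_const_mul, kernelZero] using h
  · refine Summable.of_nonneg_of_le (fun m => integral_nonneg fun _ => norm_nonneg _) (fun m => ?_)
      ((hφ.summable_norm_translate hM x).mul_right (∫ y, ‖φ y‖))
    calc ∫ y in K, ‖kernelTerm φ x y m‖ ≤ ∫ y, ‖kernelTerm φ x y m‖ :=
          setIntegral_le_integral (hint' m).norm (ae_of_all _ fun _ => norm_nonneg _)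
      _ = ‖φ (x - latticePoint m)‖ * ∫ y, ‖φ (y - latticePoint m)‖ := by
          simp [kernelTerm, integral_const_mul]
      _ = _ := by rw [integral_sub_right_eq_self (fun y => ‖φ y‖)]

lemma HasDecay.integrable_kernelZero (hM : IsGrowthFunction M) (hφ : HasDecay M φ)
    (hc : Continuous φ) (x : Rn n) : Integrable (kernelZero φ x) := by
  obtain ⟨C, hC, h⟩ := hφ.norm_kernelZero_le hM 1
  obtain ⟨a, ha, b, hab⟩ := exists_linear_le_growth hM
  have hi := ((integrable_exp_neg_mul_norm (n := n) ha).comp_sub_left x).const_mul (C * Real.exp b)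
  refine hi.mono' (measurable_kernelZero hc x).aestronglyMeasurable (ae_of_all _ fun y => ?_)
  refine (h x y).trans ?_
  rw [mul_assoc, ← Real.exp_add]
  refine mul_le_mul_of_nonneg_left (Real.exp_le_exp.2 ?_) hC
  have := hab ‖x - y‖
  simp only [Nat.cast_one, one_mul]
  linarith

/-- Exhibits the integral as a constant times the periodization of `φ`, from which its continuity
and periodicity in `x` follow. -/
lemma HasDecay.integral_kernelZero_eq (hM : IsGrowthFunction M) (hφ : HasDecay M φ)
    (hc : Continuous φ) (x : Rn n) :
    ∫ y, kernelZero φ x y = (∑' m, φ (x - latticePoint m)) * ∫ y, starRingEnd ℂ (φ y) := by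
  have h := (hφ.hasSum_setIntegral_kernelZero hM hc Set.univ x).tsum_eq
  simp only [setIntegral_univ] at h
  rw [← h, ← tsum_mul_right]
  refine tsum_congr fun m => ?_
  rw [integral_sub_right_eq_self (fun y => starRingEnd ℂ (φ y))]

/-- The part of the kernel away from the diagonal has small integral. -/
lemma HasDecay.norm_setIntegral_compl_le (hM : IsGrowthFunction M) (hφ : HasDecay M φ)
    (hc : Continuous φ) : ∃ a > 0, ∃ C : ℝ, ∀ (x : Rn n) (K : Set (Rn n)) (R : ℝ),
      MeasurableSet K → (∀ y ∉ K, R ≤ ‖x - y‖) →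
      ‖(∫ y, kernelZero φ x y) - ∫ y in K, kernelZero φ x y‖ ≤ C * Real.exp (-(a * R)) := by
  obtain ⟨C, hC, h⟩ := hφ.norm_kernelZero_le hM 1
  obtain ⟨a, ha, b, hab⟩ := exists_linear_le_growth hM
  set I := ∫ y : Rn n, Real.exp (-(a / 2 * ‖y‖)) with hI
  -- Half of the exponential rate yields the factor in `R`, the other half keeps the integral
  -- finite.
  refine ⟨a / 2, by positivity, C * Real.exp b * I, fun x K R hK hR => ?_⟩
  have hi : Integrable (fun y => (C * Real.exp b * Real.exp (-(a / 2 * R))) *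
      Real.exp (-(a / 2 * ‖x - y‖))) :=
    ((integrable_exp_neg_mul_norm (n := n) (half_pos ha)).comp_sub_left x).const_mul _
  rw [← integral_add_compl hK (hφ.integrable_kernelZero hM hc x), add_sub_cancel_left]
  calc ‖∫ y in Kᶜ, kernelZero φ x y‖
      ≤ ∫ y in Kᶜ, (C * Real.exp b * Real.exp (-(a / 2 * R))) * Real.exp (-(a / 2 * ‖x - y‖)) := by
        refine norm_integral_le_of_norm_le hi.integrableOn ?_
        refine (ae_restrict_iff' hK.compl).2 (ae_of_all _ fun y hy => (h x y).trans ?_)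
        rw [mul_assoc C, mul_assoc C, ← Real.exp_add, ← Real.exp_add]
        refine mul_le_mul_of_nonneg_left (Real.exp_le_exp.2 ?_) hC
        have h1 := hab ‖x - y‖
        have h2 := hR y hy
        simp only [Nat.cast_one, one_mul]
        nlinarith
    _ ≤ ∫ y, (C * Real.exp b * Real.exp (-(a / 2 * R))) * Real.exp (-(a / 2 * ‖x - y‖)) :=
        setIntegral_le_integral hi (ae_of_all _ fun y => by positivity)
    _ = _ := by
        rw [integral_const_mul, integral_sub_left_eq_self
          (fun y : Rn n => Real.exp (-(a / 2 * ‖y‖))) volume x, ← hI]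
        ring

/-- The kernel of `V₀`, applied to the indicator function of a ball, is the best approximation. -/
lemma eLpNorm_indicator_sub_setIntegral_le (hM : IsGrowthFunction M) (hφ : HasDecay M φ)
    (hc : Continuous φ) {V₀ : Submodule ℂ (L2 n)} (hS : IsScalingFunction V₀ φ) {K : Set (Rn n)}
    (hK : MeasurableSet K) (hKfin : volume K ≠ ∞) {v : L2 n} (hv : v ∈ V₀) :
    eLpNorm (fun x => K.indicator (fun _ => (1 : ℂ)) x - ∫ y in K, kernelZero φ x y) 2 volume ≤
      eLpNorm (fun x => K.indicator (fun _ => (1 : ℂ)) x - v x) 2 volume := by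
  obtain ⟨h, hon, hspan⟩ := hS
  have hF : MemLp (K.indicator fun _ => (1 : ℂ)) 2 volume :=
    memLp_indicator_const 2 hK 1 (Or.inr hKfin)
  set e : (Fin n → ℤ) → L2 n := fun m => (h m).toLp with he
  set F : L2 n := hF.toLp with hFdef
  have hcoef : ∀ m, inner ℂ (e m) F = ∫ y in K, starRingEnd ℂ (φ (y - latticePoint m)) := by
    intro m
    rw [L2.inner_def, ← integral_indicator hK]
    refine integral_congr_ae ?_
    filter_upwards [(h m).coeFn_toLp, hF.coeFn_toLp] with y h1 h2
    rw [he, hFdef]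
    simp only [h1, h2]
    by_cases hy : y ∈ K <;> simp [hy]
  have hnorm : ‖F - v‖ₑ = eLpNorm (fun x => K.indicator (fun _ => (1 : ℂ)) x - v x) 2 volume := by
    rw [Lp.enorm_def]
    refine eLpNorm_congr_ae ?_
    filter_upwards [Lp.coeFn_sub F v, hF.coeFn_toLp] with x h1 h2
    rw [h1, Pi.sub_apply, h2]
  rw [← hnorm]
  refine ENNReal.le_of_forall_pos_le_add fun ε hε _ => ?_
  -- Fatou's lemma along the finite index sets: the norms are eventually at most `‖F - v‖ + ε`, and
  -- the partial sums converge pointwise to the absolutely convergent kernel integral. This avoids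
  -- identifying an `L²` limit.
  refine Lp.eLpNorm_le_of_ae_tendsto (u := (atTop : Filter (Finset (Fin n → ℤ))))
    (f := fun s => ⇑(F - ∑ m ∈ s, inner ℂ (e m) F • e m)) ?_
    (fun s => Lp.aestronglyMeasurable _) ?_
  · rw [← hspan] at hv
    filter_upwards [eventually_norm_sub_sum_inner_le hon F v hv (ε := ε) (by exact_mod_cast hε)]
      with s hs
    rw [← Lp.enorm_def, ← ofReal_norm, ← ofReal_norm, ← ENNReal.ofReal_coe_nnreal,
      ← ENNReal.ofReal_add (norm_nonneg _) ε.coe_nonneg]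
    exact ENNReal.ofReal_le_ofReal hs
  · have hall : ∀ᵐ x, ∀ s : Finset (Fin n → ℤ), (F - ∑ m ∈ s, inner ℂ (e m) F • e m : L2 n) x =
        K.indicator (fun _ => (1 : ℂ)) x - ∑ m ∈ s, φ (x - latticePoint m) *
          ∫ y in K, starRingEnd ℂ (φ (y - latticePoint m)) := by
      refine ae_all_iff.2 fun s => ?_
      have h0 : ∀ᵐ x, ∀ m, (inner ℂ (e m) F • e m : L2 n) x =
          inner ℂ (e m) F * φ (x - latticePoint m) := by
        refine ae_all_iff.2 fun m => ?_
        filter_upwards [Lp.coeFn_smul (inner ℂ (e m) F) (e m), (h m).coeFn_toLp] with x h1 h2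
        rw [h1, Pi.smul_apply, smul_eq_mul, he, h2]
      filter_upwards [Lp.coeFn_sub F (∑ m ∈ s, inner ℂ (e m) F • e m), hF.coeFn_toLp,
        Lp.coeFn_finsetSum s (fun m => inner ℂ (e m) F • e m), h0] with x h1 h2 h3 h4
      rw [h1, Pi.sub_apply, h2, h3, Finset.sum_apply]
      congr 1
      refine Finset.sum_congr rfl fun m _ => ?_
      rw [h4, hcoef, mul_comm]
    filter_upwards [hall] with x hx
    simp only [hx]
    exact tendsto_const_nhds.sub (hφ.hasSum_setIntegral_kernelZero hM hc K x)

lemma norm_latticePoint_le {m : Fin n → ℤ} {N : ℝ} (hN : 0 ≤ N) (hm : ∀ i, |(m i : ℝ)| ≤ N) :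
    ‖latticePoint m‖ ≤ n * N := by
  refine le_of_sq_le_sq ?_ (by positivity)
  rw [EuclideanSpace.norm_sq_eq]
  calc ∑ i, ‖(latticePoint m) i‖ ^ 2 ≤ ∑ _i : Fin n, N ^ 2 := by
        refine Finset.sum_le_sum fun i _ => ?_
        have := hm i
        simp only [latticePoint, Real.norm_eq_abs]
        gcongr
    _ = n * N ^ 2 := by simp
    _ ≤ (n : ℝ) ^ 2 * N ^ 2 := by
        gcongr
        exact_mod_cast Nat.le_self_pow two_ne_zero n
    _ = _ := by ring

/-- The reproducing kernel of a multiresolution analysis reproduces constants. -/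
theorem integral_kernelZero_eq_one (hM : IsGrowthFunction M) (hφ : HasDecay M φ)
    (hc : Continuous φ) {V : ℤ → Submodule ℂ (L2 n)} (hV : IsMRA V)
    (hS : IsScalingFunction (V 0) φ) (x₀ : Rn n) : ∫ y, kernelZero φ x₀ y = 1 := by
  by_contra hne
  set c : Rn n → ℂ := fun x => ∫ y, kernelZero φ x y with hcdef
  have hceq : c = fun x => (∑' m, φ (x - latticePoint m)) * ∫ y, starRingEnd ℂ (φ y) :=
    funext fun x => hφ.integral_kernelZero_eq hM hc x
  have hcont : Continuous c := by
    rw [hceq]; exact (hφ.continuous_tsum_translate hM hc).mul continuous_const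
  have hper : ∀ x p, c (x - latticePoint p) = c x := by
    intro x p
    rw [hceq]
    simp only [tsum_translate_periodic]
  set δ : ℝ := ‖c x₀ - 1‖ / 2 with hδ
  have hδ0 : 0 < δ := half_pos (norm_pos_iff.2 (sub_ne_zero.2 hne))
  obtain ⟨r', hr', hball⟩ := Metric.continuousAt_iff.1 (hcont.continuousAt (x := x₀)) δ hδ0
  set r : ℝ := min r' (1 / 2) with hr
  have hr0 : 0 < r := lt_min hr' (by norm_num)
  have hr2 : r ≤ 1 / 2 := min_le_right _ _
  have hlow : ∀ x ∈ Metric.ball x₀ r, δ ≤ ‖c x - 1‖ := by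
    intro x hx
    have h1 := hball (lt_of_lt_of_le (Metric.mem_ball.1 hx) (min_le_left _ _))
    rw [dist_eq_norm] at h1
    have h2 : ‖c x₀ - 1‖ ≤ ‖c x - 1‖ + ‖c x - c x₀‖ := by
      have := norm_sub_le (c x - 1) (c x - c x₀)
      rwa [sub_sub_sub_cancel_left] at this
    linarith
  obtain ⟨a, ha, C, hC⟩ := hφ.norm_setIntegral_compl_le hM hc
  -- Large enough that, after scaling by `2^j`, all the translated balls used below stay at distance
  -- at least `2^j` from the complement of `K`.
  set ρ : ℝ := ‖x₀‖ + n + 2 with hρ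
  set B : Set (Rn n) := Metric.ball 0 ρ with hB
  have hF : MemLp (B.indicator fun _ => (1 : ℂ)) 2 volume :=
    memLp_indicator_const 2 measurableSet_ball 1 (Or.inr measure_ball_lt_top.ne)
  set w : ℝ≥0∞ := volume (Metric.ball x₀ r) with hw
  have hw0 : w ≠ 0 := (Metric.measure_ball_pos _ _ hr0).ne'
  -- With this `ε` the approximation error per ball is less than the contribution `(δ/2)² w` forced
  -- on each ball.
  obtain ⟨ε, hε0, hε⟩ : ∃ ε : ℝ≥0∞, 0 < ε ∧ ε ^ (2 : ℝ) < ENNReal.ofReal (δ / 2) ^ (2 : ℝ) * w := by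
    have hpos : 0 < ENNReal.ofReal (δ / 2) ^ (2 : ℝ) * w :=
      pos_iff_ne_zero.2 (mul_ne_zero (by simpa using half_pos hδ0) hw0)
    have ht : Tendsto (fun ε : ℝ≥0∞ => ε ^ (2 : ℝ)) (𝓝[>] 0) (𝓝 0) := by
      have := (ENNReal.continuous_rpow_const (y := 2)).tendsto 0
      rw [ENNReal.zero_rpow_of_pos two_pos] at this
      exact this.mono_left nhdsWithin_le_nhds
    obtain ⟨ε, h1, h2⟩ := ((ht.eventually_lt_const hpos).and self_mem_nhdsWithin).exists
    exact ⟨ε, h2, h1⟩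
  obtain ⟨J, hJ⟩ := hV.exists_near hF hε0
  obtain ⟨j, hjJ, hj⟩ : ∃ j ≥ J, C * Real.exp (-(a * 2 ^ j)) ≤ δ / 2 := by
    have ht : Tendsto (fun j : ℕ => C * Real.exp (-(a * 2 ^ j))) atTop (𝓝 (C * 0)) := by
      refine Tendsto.const_mul _ (Real.tendsto_exp_neg_atTop_nhds_zero.comp ?_)
      exact (tendsto_pow_atTop_atTop_of_one_lt one_lt_two).const_mul_atTop ha
    rw [mul_zero] at ht
    obtain ⟨j, h1, h2⟩ := ((ht.eventually_lt_const (half_pos hδ0)).and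
      (eventually_ge_atTop J)).exists
    exact ⟨j, h2, h1.le⟩
  obtain ⟨v, hv, hvle⟩ := hJ j hjJ
  set K : Set (Rn n) := Metric.ball 0 (2 ^ j * ρ) with hK
  have hKB : ∀ x : Rn n, ((1 / 2 : ℝ) ^ j) • x ∈ B ↔ x ∈ K := by
    intro x
    rw [hB, hK, mem_ball_zero_iff, mem_ball_zero_iff, norm_smul, Real.norm_eq_abs,
      abs_of_pos (by positivity), one_div, inv_pow, inv_mul_lt_iff₀ (by positivity)]
  have hFK : ∀ x : Rn n, B.indicator (fun _ => (1 : ℂ)) (((1 / 2 : ℝ) ^ j) • x) =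
      K.indicator (fun _ => (1 : ℂ)) x := by
    intro x
    by_cases hx : x ∈ K
    · rw [Set.indicator_of_mem hx, Set.indicator_of_mem ((hKB x).2 hx)]
    · rw [Set.indicator_of_notMem hx, Set.indicator_of_notMem (mt (hKB x).1 hx)]
  simp only [hFK] at hvle
  have hbest := (eLpNorm_indicator_sub_setIntegral_le hM hφ hc hS (measurableSet_ball : MeasurableSet K)
    measure_ball_lt_top.ne hv).trans hvle
  set D : Rn n → ℂ := fun x => K.indicator (fun _ => (1 : ℂ)) x - ∫ y in K, kernelZero φ x y with hD
  have hDm : AEStronglyMeasurable D volume := by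
    refine Measurable.aestronglyMeasurable ?_
    refine (measurable_const.indicator measurableSet_ball).sub ?_
    have : (fun x => ∫ y in K, kernelZero φ x y) = fun x => ∑' m : Fin n → ℤ,
        φ (x - latticePoint m) * ∫ y in K, starRingEnd ℂ (φ (y - latticePoint m)) :=
      funext fun x => (hφ.hasSum_setIntegral_kernelZero hM hc K x).tsum_eq.symm
    rw [this]
    exact Measurable.tsum fun m =>
      ((hc.comp (continuous_id.sub continuous_const)).measurable).mul_const _
  -- Chebyshev's inequality turns the lower bound on the error into a lower bound on its `L²` norm.
  have hcheb := mul_meas_ge_le_pow_eLpNorm' volume two_ne_zero ENNReal.ofNat_ne_top hDm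
    (ENNReal.ofReal (δ / 2))
  -- The lattice points of the cube `[0, 2^j)^n`: their number `2^(jn)` is exactly the scaling
  -- factor of the squared error.
  set T : Finset (Fin n → ℤ) := Fintype.piFinset fun _ => (Finset.range (2 ^ j)).map Nat.castEmbedding
    with hT
  have hTcard : T.card = 2 ^ (j * n) := by
    rw [hT, Fintype.card_piFinset]
    simp [pow_mul]
  have hp1 : (1 : ℝ) ≤ 2 ^ j := one_le_pow₀ one_le_two
  have hsub : (⋃ m ∈ T, Metric.ball (x₀ + latticePoint m) r) ⊆
      {x | ENNReal.ofReal (δ / 2) ≤ ‖D x‖ₑ} := by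
    intro x hx
    obtain ⟨m, hm, hxm⟩ := Set.mem_iUnion₂.1 hx
    have hmN : ‖latticePoint m‖ ≤ n * 2 ^ j := by
      refine norm_latticePoint_le (by positivity) fun i => ?_
      have h1 := Fintype.mem_piFinset.1 hm i
      obtain ⟨k, hk, hki⟩ := Finset.mem_map.1 h1
      have hk' := Finset.mem_range.1 hk
      rw [← hki]
      simp only [Nat.castEmbedding_apply, Int.cast_natCast, Nat.abs_cast]
      exact_mod_cast hk'.le
    rw [mem_ball_iff_norm] at hxm
    have hxn : ‖x‖ + 2 ^ j ≤ 2 ^ j * ρ := by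
      have h1 : ‖x‖ ≤ ‖x - (x₀ + latticePoint m)‖ + (‖x₀‖ + ‖latticePoint m‖) := by
        calc ‖x‖ = ‖(x - (x₀ + latticePoint m)) + (x₀ + latticePoint m)‖ := by
              rw [sub_add_cancel]
          _ ≤ _ := (norm_add_le _ _).trans (by gcongr; exact norm_add_le _ _)
      have h2 : ‖x₀‖ ≤ 2 ^ j * ‖x₀‖ := le_mul_of_one_le_left (norm_nonneg _) hp1
      rw [hρ]
      nlinarith
    have hxK : x ∈ K := by
      rw [hK, mem_ball_zero_iff]
      have : (0 : ℝ) < 2 ^ j := by positivity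
      linarith
    have htail := hC x K (2 ^ j) measurableSet_ball (by
      intro y hy
      rw [hK, mem_ball_zero_iff, not_lt] at hy
      have := norm_sub_norm_le y x
      rw [norm_sub_rev] at this
      linarith)
    have hcx : δ ≤ ‖c x - 1‖ := by
      rw [← hper x m]
      refine hlow _ ?_
      rw [mem_ball_iff_norm, sub_right_comm, sub_sub]
      exact hxm
    -- Inside `K` the error is the tail of the integral, at most `δ/2`, minus `c x - 1`, at least
    -- `δ`.
    have hDx : D x = (c x - ∫ y in K, kernelZero φ x y) - (c x - 1) := by
      rw [hD]
      simp only [Set.indicator_of_mem hxK]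
      ring
    have h3 : δ / 2 ≤ ‖D x‖ := by
      have := norm_sub_norm_le (c x - 1) (c x - ∫ y in K, kernelZero φ x y)
      rw [hDx, norm_sub_rev]
      linarith
    rw [Set.mem_ofPred_eq, ← ofReal_norm]
    exact ENNReal.ofReal_le_ofReal h3
  have hvol : volume (⋃ m ∈ T, Metric.ball (x₀ + latticePoint m) r) =
      ENNReal.ofReal ((2 : ℝ) ^ (j * n)) * w := by
    rw [measure_biUnion_finset (fun m _ m' _ h => disjoint_ball_latticePoint hr2 x₀ h)
      fun _ _ => measurableSet_ball]
    have : ∀ m ∈ T, volume (Metric.ball (x₀ + latticePoint m) r) = w := fun m _ => by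
      rw [hw, Measure.addHaar_ball_center, Measure.addHaar_ball_center volume x₀]
    rw [Finset.sum_congr rfl this, Finset.sum_const, hTcard, nsmul_eq_mul,
      ENNReal.ofReal_pow two_pos.le]
    simp
  have hfinal : ENNReal.ofReal (δ / 2) ^ (2 : ℝ) * (ENNReal.ofReal ((2 : ℝ) ^ (j * n)) * w) ≤
      ENNReal.ofReal ((2 : ℝ) ^ (j * n)) * ε ^ (2 : ℝ) := by
    calc _ ≤ ENNReal.ofReal (δ / 2) ^ (2 : ℝ) * volume {x | ENNReal.ofReal (δ / 2) ≤ ‖D x‖ₑ} := by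
          rw [← hvol]; gcongr
      _ ≤ eLpNorm D 2 volume ^ (2 : ℝ) := by simpa using hcheb
      _ ≤ (ENNReal.ofReal ((2 : ℝ) ^ (j * n)) ^ (1 / 2 : ℝ) * ε) ^ (2 : ℝ) := by gcongr
      _ = _ := by
          rw [ENNReal.mul_rpow_of_nonneg _ _ two_pos.le, ← ENNReal.rpow_mul]
          norm_num
  rw [mul_left_comm, ENNReal.mul_le_mul_iff_right (by simp) ENNReal.ofReal_ne_top] at hfinal
  exact absurd hε (not_lt.2 hfinal)

/-- All the kernels reproduce constants. -/
theorem integral_kernel_eq_one (hM : IsGrowthFunction M) (hφ : HasDecay M φ)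
    (hc : Continuous φ) {V : ℤ → Submodule ℂ (L2 n)} (hV : IsMRA V)
    (hS : IsScalingFunction (V 0) φ) (t : ℝ) (x : Rn n) : ∫ y, kernel φ t x y = 1 := by
  have h2 : (0 : ℝ) < 2 ^ t := Real.rpow_pos_of_pos two_pos t
  simp only [kernel]
  rw [integral_const_mul, Measure.integral_comp_smul volume (kernelZero φ ((2 : ℝ) ^ t • x)),
    integral_kernelZero_eq_one hM hφ hc hV hS, finrank_euclideanSpace_fin, abs_of_pos (by positivity),
    mul_comm (n : ℝ), Real.rpow_mul two_pos.le, Real.rpow_natCast, Complex.real_smul, mul_one,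
    ← Complex.ofReal_mul, mul_inv_cancel₀ (by positivity), Complex.ofReal_one]

end ConstantReproduction

/-! ### Total variation of complex measures, and integrals against multiples of a positive measure.
-/

section ComplexMeasure

variable {X : Type*} [MeasurableSpace X]

lemma variation_le_re_add_im (ν : ComplexMeasure X) :
    ν.variation ≤ (ComplexMeasure.re ν).variation + (ComplexMeasure.im ν).variation := by
  refine VectorMeasure.variation_le_of_forall_enorm_le fun s hs => ?_
  rw [Measure.add_apply]
  refine le_trans ?_ (add_le_add (VectorMeasure.enorm_measure_le_variation _ s)
    (VectorMeasure.enorm_measure_le_variation _ s))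
  have h1 : ν s = ((ν s).re : ℂ) + ((ν s).im : ℂ) * Complex.I := (Complex.re_add_im _).symm
  have h2 : (ComplexMeasure.re ν) s = (ν s).re := rfl
  have h3 : (ComplexMeasure.im ν) s = (ν s).im := rfl
  rw [h2, h3, ← ofReal_norm, ← ofReal_norm, ← ofReal_norm,
    ← ENNReal.ofReal_add (norm_nonneg _) (norm_nonneg _)]
  exact ENNReal.ofReal_le_ofReal (Complex.norm_le_abs_re_add_abs_im _)

lemma signedMeasure_variation_le (ν : SignedMeasure X) {s : Set X} (hs : MeasurableSet s)
    {c : ℝ≥0∞} (h : ∀ t ⊆ s, MeasurableSet t → ‖ν t‖ₑ ≤ c) : ν.variation s ≤ 2 * c := by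
  by_contra! hlt
  obtain ⟨t, hts, ht, h2⟩ := SignedMeasure.exists_subset_lt_enorm_apply_of_lt_variation ν hs hlt
  exact absurd h2 (not_lt.2 (by gcongr; exact h t hts ht))

/-- The total variation of a complex measure is at most four times the supremum of its values. -/
lemma complexMeasure_variation_le (ν : ComplexMeasure X) {s : Set X} (hs : MeasurableSet s)
    {c : ℝ≥0∞} (h : ∀ t ⊆ s, MeasurableSet t → ‖ν t‖ₑ ≤ c) : ν.variation s ≤ 4 * c := by
  refine (variation_le_re_add_im ν s).trans ?_
  rw [Measure.add_apply, show (4 : ℝ≥0∞) = 2 + 2 by norm_num, add_mul]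
  refine add_le_add (signedMeasure_variation_le _ hs fun t hts ht => le_trans ?_ (h t hts ht))
    (signedMeasure_variation_le _ hs fun t hts ht => le_trans ?_ (h t hts ht))
  · rw [← ofReal_norm, ← ofReal_norm]
    exact ENNReal.ofReal_le_ofReal (Complex.abs_re_le_norm _)
  · rw [← ofReal_norm, ← ofReal_norm]
    exact ENNReal.ofReal_le_ofReal (Complex.abs_im_le_norm _)

instance isFiniteMeasure_variation_complexMeasure (ν : ComplexMeasure X) :
    IsFiniteMeasure ν.variation := by
  refine ⟨(complexMeasure_variation_le ν MeasurableSet.univ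
    fun t _ _ => VectorMeasure.enorm_apply_le_bound).trans_lt ?_⟩
  finiteness

/-- The complex measure `γ • m`, for a finite positive measure `m`. -/
noncomputable def constMulMeasure (m : Measure X) [IsFiniteMeasure m] (γ : ℂ) : ComplexMeasure X :=
  m.toSignedMeasure.mapRange ((AddMonoidHom.mulLeft γ).comp Complex.ofRealHom.toAddMonoidHom)
    (continuous_const.mul Complex.continuous_ofReal)

lemma constMulMeasure_apply (m : Measure X) [IsFiniteMeasure m] (γ : ℂ) {s : Set X}
    (hs : MeasurableSet s) : constMulMeasure m γ s = γ * (m.real s : ℂ) := by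
  simp [constMulMeasure, hs]

lemma variation_constMulMeasure_le (m : Measure X) [IsFiniteMeasure m] (γ : ℂ) :
    (constMulMeasure m γ).variation ≤ ‖γ‖ₑ • m := by
  refine VectorMeasure.variation_le_of_forall_enorm_le fun s hs => ?_
  rw [constMulMeasure_apply m γ hs, enorm_mul, Measure.smul_apply, smul_eq_mul]
  gcongr
  rw [← ofReal_norm, Complex.norm_real, Real.norm_of_nonneg measureReal_nonneg]
  simp

/-- The integral is an extension from simple functions controlled by the variation. Since `‖γ‖ m`
dominates the variation, it agrees with the extension controlled by `m`, where induction over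
integrable functions applies. -/
lemma integral_constMulMeasure (m : Measure X) [IsFiniteMeasure m] (γ : ℂ) {g : X → ℂ}
    (hg : Integrable g m) :
    (constMulMeasure m γ).integral g (ContinuousLinearMap.mul ℝ ℂ) = γ * ∫ x, g x ∂m := by
  set T := (constMulMeasure m γ).transpose (ContinuousLinearMap.mul ℝ ℂ) with hT
  have hTs : ∀ s, MeasurableSet s → ∀ x : ℂ, T s x = x * (γ * (m.real s : ℂ)) := by
    intro s hs x
    rw [hT, transpose_eq_cbmApplyMeasure, cbmApplyMeasure_apply, constMulMeasure_apply m γ hs]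
    rfl
  have hdom : DominatedFinMeasAdditive m T ‖γ‖ := by
    refine ⟨fun s t hs ht _ _ hd => VectorMeasure.of_union hd hs ht, fun s hs _ => ?_⟩
    refine ContinuousLinearMap.opNorm_le_bound _ (by positivity) fun x => ?_
    rw [hTs s hs, norm_mul, norm_mul, Complex.norm_real, Real.norm_of_nonneg measureReal_nonneg,
      mul_comm]
  rw [VectorMeasure.integral_eq_setToFun, ← setToFun_congr_measure_of_integrable ‖γ‖ₑ
    enorm_ne_top (variation_constMulMeasure_le m γ) hdom _ g hg]
  refine hg.induction (P := fun g => setToFun m T hdom g = γ * ∫ x, g x ∂m) ?_ ?_ ?_ ?_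
  · intro c s hs hsm
    rw [setToFun_indicator_const hdom hs hsm.ne, hTs s hs, integral_indicator_const _ hs,
      Complex.real_smul]
    ring
  · intro f g _ hf hg h1 h2
    rw [setToFun_add hdom hf hg, h1, h2]
    simp only [Pi.add_apply]
    rw [integral_add hf hg, mul_add]
  · exact isClosed_eq (continuous_setToFun hdom) (continuous_const.mul continuous_integral)
  · intro f g hfg _ h
    rw [← setToFun_congr_ae hdom hfg, h, integral_congr_ae hfg]

end ComplexMeasure

/-! ### Complex Radon measures, their shells and their total variation. -/

namespace ComplexRadonMeasure

variable {n : ℕ}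

lemma restrict_apply (μ : ComplexRadonMeasure n) {K : Set (Rn n)} (hK : MeasurableSet K)
    (hb : Bornology.IsBounded K) {A : Set (Rn n)} (hA : MeasurableSet A) :
    μ.restrict K hK hb A = μ.toFun (A ∩ K) := by
  classical
  change (if MeasurableSet A then μ.toFun (A ∩ K) else 0) = _
  rw [if_pos hA]

lemma shellPart_apply (μ : ComplexRadonMeasure n) (N : ℕ) {A : Set (Rn n)} (hA : MeasurableSet A) :
    μ.shellPart N A = μ.toFun (A ∩ shell n N) := restrict_apply _ _ _ hA

lemma toFun_union (μ : ComplexRadonMeasure n) {A B : Set (Rn n)} (hA : MeasurableSet A)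
    (hB : MeasurableSet B) (hbA : Bornology.IsBounded A) (hbB : Bornology.IsBounded B)
    (hd : Disjoint A B) : μ.toFun (A ∪ B) = μ.toFun A + μ.toFun B := by
  have h := VectorMeasure.of_union (v := μ.restrict (A ∪ B) (hA.union hB) (hbA.union hbB)) hd hA hB
  rw [restrict_apply _ _ _ hA, restrict_apply _ _ _ hB, restrict_apply _ _ _ (hA.union hB)] at h
  rwa [Set.inter_self, Set.inter_eq_left.2 Set.subset_union_left,
    Set.inter_eq_left.2 Set.subset_union_right] at h

end ComplexRadonMeasure

section Shell

variable {n : ℕ}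

lemma iUnion_shell : ⋃ N, shell n N = Set.univ := by
  refine Set.eq_univ_of_forall fun x => Set.mem_iUnion.2 ⟨⌊‖x‖⌋₊, ?_⟩
  exact ⟨Nat.floor_le (norm_nonneg _), Nat.lt_floor_add_one _⟩

lemma disjoint_shell : Pairwise (Function.onFun Disjoint (shell n)) := by
  intro N N' h
  refine Set.disjoint_left.2 fun x hx hx' => h ?_
  rw [← (Nat.floor_eq_iff (norm_nonneg x)).2 hx, ← (Nat.floor_eq_iff (norm_nonneg x)).2 hx']

instance isFiniteMeasure_restrict_shell (N : ℕ) :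
    IsFiniteMeasure ((volume : Measure (Rn n)).restrict (shell n N)) :=
  ⟨by rw [Measure.restrict_apply_univ]; exact (isBounded_shell N).measure_lt_top⟩

lemma sum_restrict_shell (m : Measure (Rn n)) : (Measure.sum fun N => m.restrict (shell n N)) = m := by
  rw [← Measure.restrict_iUnion disjoint_shell measurableSet_shell, iUnion_shell,
    Measure.restrict_univ]

end Shell

namespace ComplexRadonMeasure

variable {n : ℕ}

/-- Links the shellwise total variation to a single finite complex measure, so that bounds for the
latter apply on bounded sets that meet several shells. -/
lemma variation_le_restrict (μ : ComplexRadonMeasure n) {K : Set (Rn n)} (hK : MeasurableSet K)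
    (hb : Bornology.IsBounded K) {E : Set (Rn n)} (hE : MeasurableSet E) (hEK : E ⊆ K) :
    μ.variation E ≤ (μ.restrict K hK hb).variation E := by
  rw [variation, Measure.sum_apply _ hE]
  conv_rhs => rw [← sum_restrict_shell (μ.restrict K hK hb).variation, Measure.sum_apply _ hE]
  refine ENNReal.tsum_le_tsum fun N => ?_
  refine VectorMeasure.variation_apply_le_of_forall_enorm_le hE fun A hA hAE => ?_
  rw [shellPart_apply _ _ hA, Measure.restrict_apply hA]
  have hAN := hA.inter (measurableSet_shell N)
  have : μ.toFun (A ∩ shell n N) = μ.restrict K hK hb (A ∩ shell n N) := by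
    rw [restrict_apply _ _ _ hAN, Set.inter_eq_left.2
      (Set.inter_subset_left.trans (hAE.trans hEK))]
  rw [this]
  exact VectorMeasure.enorm_measure_le_variation _ _

lemma variation_lt_top (μ : ComplexRadonMeasure n) {K : Set (Rn n)} (hK : MeasurableSet K)
    (hb : Bornology.IsBounded K) : μ.variation K < ∞ :=
  (μ.variation_le_restrict hK hb hK subset_rfl).trans_lt (measure_lt_top _ _)

/-- The total variation is at most four times the supremum of the values. -/
lemma variation_le_four_mul (μ : ComplexRadonMeasure n) {K : Set (Rn n)} (hK : MeasurableSet K)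
    (hb : Bornology.IsBounded K) {c : ℝ≥0∞}
    (h : ∀ A ⊆ K, MeasurableSet A → ‖μ.toFun A‖ₑ ≤ c) : μ.variation K ≤ 4 * c := by
  refine (μ.variation_le_restrict hK hb hK subset_rfl).trans
    (complexMeasure_variation_le _ hK fun A hAK hA => ?_)
  rw [restrict_apply _ _ _ hA, Set.inter_eq_left.2 hAK]
  exact h A hAK hA

lemma enorm_toFun_le (μ : ComplexRadonMeasure n) {B : Set (Rn n)} (hB : MeasurableSet B)
    (hb : Bornology.IsBounded B) : ‖μ.toFun B‖ₑ ≤ μ.variation B := by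
  have hU : ⋃ N, B ∩ shell n N = B := by rw [← Set.inter_iUnion, iUnion_shell, Set.inter_univ]
  have h := μ.hasSum_iUnion' (fun N => B ∩ shell n N) (fun N => hB.inter (measurableSet_shell N))
    (fun i j hij => (disjoint_shell hij).mono Set.inter_subset_right Set.inter_subset_right)
    (by rw [hU]; exact hb)
  rw [hU] at h
  rw [← h.tsum_eq, variation, Measure.sum_apply _ hB]
  refine enorm_tsum_le_tsum_enorm.trans (ENNReal.tsum_le_tsum fun N => ?_)
  rw [← shellPart_apply _ _ hB]
  exact VectorMeasure.enorm_measure_le_variation _ _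

instance isLocallyFinite_variation (μ : ComplexRadonMeasure n) :
    IsLocallyFiniteMeasure μ.variation :=
  ⟨fun x => ⟨Metric.ball x 1, Metric.ball_mem_nhds x one_pos,
    μ.variation_lt_top measurableSet_ball Metric.isBounded_ball⟩⟩

lemma enorm_integral_le (μ : ComplexRadonMeasure n) (g : Rn n → ℂ) :
    ‖μ.integral g‖ₑ ≤ ∫⁻ x, ‖g x‖ₑ ∂μ.variation := by
  rw [integral, variation, lintegral_sum_measure]
  refine enorm_tsum_le_tsum_enorm.trans (ENNReal.tsum_le_tsum fun N => ?_)
  refine VectorMeasure.enorm_integral_le_lintegral_enorm.trans ?_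
  refine mul_le_of_le_one_left (by positivity) ?_
  rw [← ofReal_norm, ENNReal.ofReal_le_one]
  exact ContinuousLinearMap.opNorm_mul_le ℝ ℂ

/-- The difference `μ - γ m`, where `m` is Lebesgue measure. -/
noncomputable def subConst (μ : ComplexRadonMeasure n) (γ : ℂ) : ComplexRadonMeasure n where
  toFun B := μ.toFun B - γ * (volume.real B : ℂ)
  empty' := by simp [μ.empty']
  hasSum_iUnion' B hB hd hb := by
    refine (μ.hasSum_iUnion' B hB hd hb).sub (HasSum.mul_left γ ?_)
    refine Complex.hasSum_ofReal.2 ?_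
    have h : volume (⋃ i, B i) ≠ ∞ := hb.measure_lt_top.ne
    have h2 := measure_iUnion (μ := volume) hd hB
    have h3 : ∑' i, volume (B i) ≠ ∞ := h2 ▸ h
    simp only [measureReal_def]
    rw [h2, ENNReal.tsum_toReal_eq (ENNReal.ne_top_of_tsum_ne_top h3)]
    exact (ENNReal.summable_toReal h3).hasSum

lemma subConst_toFun (μ : ComplexRadonMeasure n) (γ : ℂ) (B : Set (Rn n)) :
    (μ.subConst γ).toFun B = μ.toFun B - γ * (volume.real B : ℂ) := rfl

lemma shellPart_subConst (μ : ComplexRadonMeasure n) (γ : ℂ) (N : ℕ) :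
    (μ.subConst γ).shellPart N =
      μ.shellPart N - constMulMeasure (volume.restrict (shell n N)) γ := by
  ext A hA
  rw [sub_apply, shellPart_apply _ _ hA, shellPart_apply _ _ hA,
    constMulMeasure_apply _ _ hA, subConst_toFun, measureReal_restrict_apply hA]

lemma variation_subConst_le (μ : ComplexRadonMeasure n) (γ : ℂ) :
    (μ.subConst γ).variation ≤ μ.variation + ‖γ‖ₑ • volume := by
  have h : (Measure.sum fun N => (μ.shellPart N).variation +
      ‖γ‖ₑ • (volume : Measure (Rn n)).restrict (shell n N)) = μ.variation + ‖γ‖ₑ • volume := by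
    ext A hA
    conv_rhs => rw [← sum_restrict_shell (volume : Measure (Rn n))]
    simp only [variation, Measure.add_apply, Measure.smul_apply, Measure.sum_apply _ hA, smul_eq_mul,
      ENNReal.tsum_add, ENNReal.tsum_mul_left]
  rw [← h]
  refine Measure.le_iff.2 fun A hA => ?_
  rw [variation, Measure.sum_apply _ hA, Measure.sum_apply _ hA]
  refine ENNReal.tsum_le_tsum fun N => ?_
  rw [shellPart_subConst]
  exact (VectorMeasure.variation_sub_le.trans
    (add_le_add le_rfl (variation_constMulMeasure_le _ γ))) A

/-- For a kernel of integral one this says that passing to `μ - γ m` subtracts exactly `γ` from the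
expansion. -/
lemma integral_subConst (μ : ComplexRadonMeasure n) (γ : ℂ) {g : Rn n → ℂ}
    (hμ : Integrable g μ.variation) (hg : Integrable g volume) :
    (μ.subConst γ).integral g = μ.integral g - γ * ∫ x, g x := by
  have hN : ∀ N, Integrable g (μ.shellPart N).variation := fun N =>
    hμ.mono_measure (Measure.le_sum _ N)
  have hterm : ∀ N, ((μ.subConst γ).shellPart N).integral g (ContinuousLinearMap.mul ℝ ℂ) =
      (μ.shellPart N).integral g (ContinuousLinearMap.mul ℝ ℂ) -
        γ * ∫ x in shell n N, g x := by
    intro N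
    rw [shellPart_subConst, VectorMeasure.integral_sub_vectorMeasure (hN N),
      integral_constMulMeasure _ _ hg.integrableOn]
    exact (hg.integrableOn (s := shell n N)).smul_measure (c := ‖γ‖ₑ) enorm_ne_top |>.mono_measure
      (variation_constMulMeasure_le _ γ)
  have hsum1 : Summable fun N => (μ.shellPart N).integral g (ContinuousLinearMap.mul ℝ ℂ) := by
    have hlt : ∑' N, ∫⁻ x, ‖g x‖ₑ ∂(μ.shellPart N).variation ≠ ∞ := by
      rw [← lintegral_sum_measure]; exact hμ.2.ne
    refine Summable.of_norm_bounded (ENNReal.summable_toReal hlt) fun N => ?_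
    rw [← toReal_enorm]
    refine ENNReal.toReal_mono (ENNReal.ne_top_of_tsum_ne_top hlt N) ?_
    refine VectorMeasure.enorm_integral_le_lintegral_enorm.trans ?_
    refine mul_le_of_le_one_left (by positivity) ?_
    rw [← ofReal_norm, ENNReal.ofReal_le_one]
    exact ContinuousLinearMap.opNorm_mul_le ℝ ℂ
  have hsum2 : HasSum (fun N => ∫ x in shell n N, g x) (∫ x, g x) := by
    have := hasSum_integral_iUnion measurableSet_shell disjoint_shell
      (hg.integrableOn (s := ⋃ N, shell n N))
    rwa [iUnion_shell, setIntegral_univ] at this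
  rw [integral, tsum_congr hterm, hsum1.tsum_sub (hsum2.mul_left γ).summable, integral,
    (hsum2.mul_left γ).tsum_eq]

end ComplexRadonMeasure

/-! ### From density points to small total variation. -/

section DensityPoint

variable {n : ℕ}

lemma volume_real_ball (x : Rn n) {r : ℝ} (hr : 0 < r) :
    volume.real (Metric.ball x r) = r ^ n * volume.real (Metric.ball (0 : Rn n) 1) := by
  rw [measureReal_def, Measure.addHaar_ball_of_pos _ _ hr, finrank_euclideanSpace_fin,
    ENNReal.toReal_mul, ENNReal.toReal_ofReal (by positivity), measureReal_def]

lemma volume_real_unitBall_pos : 0 < volume.real (Metric.ball (0 : Rn n) 1) :=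
  ENNReal.toReal_pos (Metric.measure_ball_pos _ _ one_pos).ne' measure_ball_lt_top.ne

/-- The values of `ρ` on the Borel subsets of small balls are small compared to the volumes of the
balls. -/
def IsNegligibleAt (ρ : ComplexRadonMeasure n) (x₀ : Rn n) : Prop :=
  ∀ η > 0, ∃ δ > 0, ∀ r, 0 < r → r ≤ δ → ∀ A ⊆ Metric.ball x₀ r, MeasurableSet A →
    ‖ρ.toFun A‖ ≤ η * r ^ n

lemma IsLebesgueDensityPoint.tendsto_subConst {μ : ComplexRadonMeasure n} {x₀ : Rn n} {γ : ℂ}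
    (h : IsLebesgueDensityPoint μ x₀ γ) {B : ℕ → Set (Rn n)} {ε : ℕ → ℝ} {a : ℝ} (ha : 0 < a)
    (hB : ∀ ν, MeasurableSet (B ν)) (hε : ∀ ν, 0 < ε ν) (hε0 : Tendsto ε atTop (𝓝 0))
    (hBε : ∀ ν, B ν ⊆ Metric.ball x₀ (ε ν)) (hBa : ∀ ν, a * ε ν ^ n ≤ volume.real (B ν)) :
    Tendsto (fun ν => ‖(μ.subConst γ).toFun (B ν)‖ / ε ν ^ n) atTop (𝓝 0) := by
  have h1 := (h B ⟨hB, ε, hε, hε0, hBε, a, ha, hBa⟩).sub_const γ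
  rw [sub_self] at h1
  have h2 := h1.norm.mul_const (volume.real (Metric.ball (0 : Rn n) 1))
  rw [norm_zero, zero_mul] at h2
  refine squeeze_zero (fun ν => by have := hε ν; positivity) (fun ν => ?_) h2
  have hεn : 0 < ε ν ^ n := pow_pos (hε ν) n
  have hm : 0 < volume.real (B ν) := lt_of_lt_of_le (by positivity) (hBa ν)
  have hm2 : volume.real (B ν) ≤ ε ν ^ n * volume.real (Metric.ball (0 : Rn n) 1) := by
    rw [← volume_real_ball x₀ (hε ν)]
    exact measureReal_mono (hBε ν) measure_ball_lt_top.ne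
  have h3 : (μ.subConst γ).toFun (B ν) =
      (μ.toFun (B ν) / (volume.real (B ν) : ℂ) - γ) * (volume.real (B ν) : ℂ) := by
    rw [ComplexRadonMeasure.subConst_toFun, sub_mul, div_mul_cancel₀]
    exact_mod_cast hm.ne'
  rw [h3, norm_mul, Complex.norm_real, Real.norm_of_nonneg hm.le, div_le_iff₀ hεn]
  calc _ ≤ ‖μ.toFun (B ν) / (volume.real (B ν) : ℂ) - γ‖ *
        (ε ν ^ n * volume.real (Metric.ball (0 : Rn n) 1)) := by gcongr
    _ = _ := by rw [measureReal_def]; ring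

/-- A bad sequence `A ν` in balls `U ν` need not shrink regularly, since its sets may be tiny. With
`E ν` the concentric ball of half the radius, the part of `A ν` inside `E ν` is joined to the
annulus `U ν \ E ν` and the part outside to `E ν`. These unions, the annuli and the half balls all
shrink regularly, and `ρ (A ν)` is a signed sum of their four values. In dimension zero the annulus
would be empty, hence `n ≠ 0`. -/
lemma IsLebesgueDensityPoint.isNegligibleAt (hn : n ≠ 0) {μ : ComplexRadonMeasure n} {x₀ : Rn n}
    {γ : ℂ} (h : IsLebesgueDensityPoint μ x₀ γ) : IsNegligibleAt (μ.subConst γ) x₀ := by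
  set ρ := μ.subConst γ with hρ
  by_contra hcon
  unfold IsNegligibleAt at hcon
  push Not at hcon
  obtain ⟨η, hη, hcon⟩ := hcon
  choose r hr0 hrδ A hAr hA hAη using fun ν : ℕ =>
    hcon (1 / ((ν : ℝ) + 1)) (by positivity)
  have hr : Tendsto r atTop (𝓝 0) :=
    squeeze_zero (fun ν => (hr0 ν).le) hrδ tendsto_one_div_add_atTop_nhds_zero_nat
  set κ := volume.real (Metric.ball (0 : Rn n) 1) with hκ
  have hκ0 : 0 < κ := volume_real_unitBall_pos
  set U : ℕ → Set (Rn n) := fun ν => Metric.ball x₀ (r ν) with hU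
  set E : ℕ → Set (Rn n) := fun ν => Metric.ball x₀ (r ν / 2) with hE
  have hEU : ∀ ν, E ν ⊆ U ν := fun ν => Metric.ball_subset_ball (by linarith [hr0 ν])
  have hUm : ∀ ν, MeasurableSet (U ν) := fun ν => measurableSet_ball
  have hEm : ∀ ν, MeasurableSet (E ν) := fun ν => measurableSet_ball
  have hUb : ∀ ν, Bornology.IsBounded (U ν) := fun ν => Metric.isBounded_ball
  have hUfin : ∀ ν, volume (U ν) ≠ ∞ := fun ν => measure_ball_lt_top.ne
  have hEvol : ∀ ν, volume.real (E ν) = κ / 2 ^ n * r ν ^ n := by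
    intro ν
    rw [hE, volume_real_ball x₀ (half_pos (hr0 ν)), div_pow]
    ring
  -- The annulus is at least as large as the half ball because `2 ^ n ≥ 2`, so one constant serves
  -- all four sequences.
  have hEvol' : ∀ ν, κ / 2 ^ n * r ν ^ n ≤ volume.real (U ν \ E ν) := by
    intro ν
    rw [measureReal_sdiff (hEU ν) (hEm ν) (hUfin ν),
      hEvol, hU, volume_real_ball x₀ (hr0 ν), ← hκ]
    have h2 : (2 : ℝ) ≤ 2 ^ n := by
      simpa using pow_le_pow_right₀ (one_le_two (α := ℝ)) (Nat.one_le_iff_ne_zero.2 hn)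
    have h3 : κ / 2 ^ n ≤ κ / 2 := by gcongr
    have h4 : 0 < r ν ^ n := pow_pos (hr0 ν) n
    nlinarith
  have hmonoU : ∀ ν {S T : Set (Rn n)}, S ⊆ T → T ⊆ U ν → volume.real S ≤ volume.real T :=
    fun ν S T h1 h2 => measureReal_mono h1 (ne_top_of_le_ne_top (hUfin ν) (measure_mono h2))
  have ha : 0 < κ / 2 ^ n := by positivity
  have t1 := h.tendsto_subConst (B := fun ν => (A ν ∩ E ν) ∪ (U ν \ E ν)) ha
    (fun ν => ((hA ν).inter (hEm ν)).union ((hUm ν).diff (hEm ν))) hr0 hr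
    (fun ν => Set.union_subset (Set.inter_subset_left.trans (hAr ν)) Set.sdiff_subset)
    (fun ν => (hEvol' ν).trans (hmonoU ν Set.subset_union_right
      (Set.union_subset (Set.inter_subset_left.trans (hAr ν)) Set.sdiff_subset)))
  have t2 := h.tendsto_subConst (B := fun ν => U ν \ E ν) ha
    (fun ν => (hUm ν).diff (hEm ν)) hr0 hr (fun ν => Set.sdiff_subset) hEvol'
  have t3 := h.tendsto_subConst (B := fun ν => (A ν \ E ν) ∪ E ν) ha
    (fun ν => ((hA ν).diff (hEm ν)).union (hEm ν)) hr0 hr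
    (fun ν => Set.union_subset (Set.sdiff_subset.trans (hAr ν)) (hEU ν))
    (fun ν => (hEvol ν).ge.trans (hmonoU ν Set.subset_union_right
      (Set.union_subset (Set.sdiff_subset.trans (hAr ν)) (hEU ν))))
  have t4 := h.tendsto_subConst (B := E) ha hEm hr0 hr hEU (fun ν => (hEvol ν).ge)
  have t := (t1.add t2).add (t3.add t4)
  simp only [add_zero] at t
  obtain ⟨ν, hν⟩ := (t.eventually_lt_const hη).exists
  rw [← hρ] at hν
  have hrn : 0 < r ν ^ n := pow_pos (hr0 ν) n
  rw [← add_div, ← add_div, ← add_div, div_lt_iff₀ hrn] at hν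
  have hb : ∀ {S : Set (Rn n)}, S ⊆ U ν → Bornology.IsBounded S := fun hS => (hUb ν).subset hS
  have e1 := ρ.toFun_union ((hA ν).inter (hEm ν)) ((hUm ν).diff (hEm ν))
    (hb (Set.inter_subset_left.trans (hAr ν))) (hb Set.sdiff_subset)
    (Set.disjoint_left.2 fun x hx hx' => hx'.2 hx.2)
  have e2 := ρ.toFun_union ((hA ν).diff (hEm ν)) (hEm ν)
    (hb (Set.sdiff_subset.trans (hAr ν))) (hb (hEU ν)) Set.disjoint_sdiff_left
  have e3 := ρ.toFun_union ((hA ν).inter (hEm ν)) ((hA ν).diff (hEm ν))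
    (hb (Set.inter_subset_left.trans (hAr ν))) (hb (Set.sdiff_subset.trans (hAr ν)))
    (Set.disjoint_left.2 fun x hx hx' => hx'.2 hx.2)
  rw [Set.inter_union_sdiff] at e3
  have e4 : ρ.toFun (A ν) = (ρ.toFun (A ν ∩ E ν ∪ U ν \ E ν) - ρ.toFun (U ν \ E ν)) +
      (ρ.toFun (A ν \ E ν ∪ E ν) - ρ.toFun (E ν)) := by rw [e1, e2, e3]; ring
  have e5 : ‖ρ.toFun (A ν)‖ ≤ (‖ρ.toFun (A ν ∩ E ν ∪ U ν \ E ν)‖ + ‖ρ.toFun (U ν \ E ν)‖) +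
      (‖ρ.toFun (A ν \ E ν ∪ E ν)‖ + ‖ρ.toFun (E ν)‖) := by
    rw [e4]
    exact (norm_add_le _ _).trans (add_le_add (norm_sub_le _ _) (norm_sub_le _ _))
  have := hAη ν
  linarith

lemma IsNegligibleAt.isLebesgueDensityPoint {μ : ComplexRadonMeasure n} {x₀ : Rn n} {γ : ℂ}
    (h : IsNegligibleAt (μ.subConst γ) x₀) : IsLebesgueDensityPoint μ x₀ γ := by
  rintro B ⟨hB, ε, hε, hε0, hBε, a, ha, hBa⟩
  rw [Metric.tendsto_atTop']
  intro e he
  obtain ⟨δ, hδ, hη⟩ := h (e * a / 2) (by positivity)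
  obtain ⟨N, hN⟩ := eventually_atTop.1 (hε0.eventually_lt_const hδ)
  refine ⟨N, fun ν hν => ?_⟩
  have h1 := hη (ε ν) (hε ν) (hN ν hν.le).le (B ν) (hBε ν) (hB ν)
  have hεn : 0 < ε ν ^ n := pow_pos (hε ν) n
  have hm : 0 < (volume (B ν)).toReal := lt_of_lt_of_le (by positivity) (hBa ν)
  have hm' : ((volume (B ν)).toReal : ℂ) ≠ 0 := by exact_mod_cast hm.ne'
  have h2 : μ.toFun (B ν) / ((volume (B ν)).toReal : ℂ) - γ =
      (μ.subConst γ).toFun (B ν) / ((volume (B ν)).toReal : ℂ) := by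
    rw [ComplexRadonMeasure.subConst_toFun, measureReal_def, sub_div, mul_div_cancel_right₀ _ hm']
  rw [dist_eq_norm, h2, norm_div, Complex.norm_real, Real.norm_of_nonneg hm.le, div_lt_iff₀ hm]
  have h3 := hBa ν
  nlinarith

/-- Uniformity over all Borel subsets is what allows the passage to the total variation; the factor
four is absorbed in `η`. -/
lemma IsNegligibleAt.variation_ball_le {ρ : ComplexRadonMeasure n} {x₀ : Rn n}
    (h : IsNegligibleAt ρ x₀) {η : ℝ} (hη : 0 < η) : ∃ δ > 0, ∀ r, 0 < r → r ≤ δ →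
      ρ.variation (Metric.ball x₀ r) ≤ ENNReal.ofReal (η * r ^ n) := by
  obtain ⟨δ, hδ, h1⟩ := h (η / 4) (by positivity)
  refine ⟨δ, hδ, fun r hr hrδ => ?_⟩
  refine (ρ.variation_le_four_mul measurableSet_ball Metric.isBounded_ball
    (c := ENNReal.ofReal (η / 4 * r ^ n)) fun A hAr hA => ?_).trans_eq ?_
  · rw [← ofReal_norm]
    exact ENNReal.ofReal_le_ofReal (h1 r hr hrδ A hAr hA)
  · rw [show (4 : ℝ≥0∞) = ENNReal.ofReal 4 by simp, ← ENNReal.ofReal_mul (by norm_num)]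
    congr 1
    ring

end DensityPoint

/-! ### Integrals of the kernel, near the point and away from it. -/

section KernelIntegral

variable {n : ℕ} {M : ℝ≥0 → ℝ≥0} {φ : Rn n → ℂ}

lemma HasDecay.integrable_kernel (hM : IsGrowthFunction M) (hφ : HasDecay M φ) (hc : Continuous φ)
    {σ : Measure (Rn n)} {k : ℝ} (hk : 0 ≤ k)
    (hσ : ∫⁻ y, ENNReal.ofReal (Real.exp (-growth M (k * ‖y‖))) ∂σ < ∞) (t : ℝ) (x : Rn n) :
    Integrable (kernel φ t x) σ := by
  have h2 : (0 : ℝ) < 2 ^ t := Real.rpow_pos_of_pos two_pos t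
  -- For small `t` the kernel is wide, so `l` must depend on `t` to make `l 2^t` at least `2k`.
  obtain ⟨l, hl⟩ := exists_nat_ge (2 * k / 2 ^ t)
  rw [div_le_iff₀ h2] at hl
  obtain ⟨C, hC, h⟩ := hφ.norm_kernel_le hM l
  have hexp : Integrable (fun y => Real.exp (-growth M (k * ‖y‖))) σ := by
    refine ⟨?_, ?_⟩
    · exact (((growth_measurable hM).comp (measurable_const.mul measurable_norm)).neg.exp).aestronglyMeasurable
    · rw [hasFiniteIntegral_iff_ofReal (ae_of_all _ fun _ => Real.exp_nonneg _)]
      exact hσ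
  refine (hexp.const_mul (C * (2 ^ t) ^ n * Real.exp (growth M (2 * k * ‖x‖)))).mono'
    (measurable_kernel hc t x).aestronglyMeasurable (ae_of_all _ fun y => (h t x y).trans ?_)
  rw [mul_assoc _ (Real.exp _), ← Real.exp_add]
  refine mul_le_mul_of_nonneg_left (Real.exp_le_exp.2 ?_) (by positivity)
  have h3 := growth_mul_norm_le hM hk x y
  have h4 : growth M (2 * k * ‖y - x‖) ≤ growth M (l * 2 ^ t * ‖x - y‖) := by
    rw [norm_sub_rev x y]
    exact growth_mono hM (by gcongr)
  linarith

lemma lintegral_exp_neg_growth_lt_top (hM : IsGrowthFunction M) {k : ℝ} (hk : 1 ≤ k) :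
    ∫⁻ y : Rn n, ENNReal.ofReal (Real.exp (-growth M (k * ‖y‖))) < ∞ := by
  obtain ⟨a, ha, b, hab⟩ := exists_linear_le_growth hM
  refine lt_of_le_of_lt (lintegral_mono fun y => ENNReal.ofReal_le_ofReal ?_)
    ((integrable_exp_neg_mul_norm (n := n) ha).const_mul (Real.exp b)).lintegral_lt_top
  rw [← Real.exp_add]
  refine Real.exp_le_exp.2 ?_
  have h1 := hab ‖y‖
  have h2 := growth_mono hM (le_mul_of_one_le_left (norm_nonneg y) hk)
  linarith

/-- The contribution of a small ball to the integral of the kernel. -/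
lemma HasDecay.setLIntegral_ball_kernel_le (hM : IsGrowthFunction M) (hφ : HasDecay M φ) :
    ∃ S : ℝ, 0 ≤ S ∧ ∀ (σ : Measure (Rn n)) (x₀ : Rn n) (η δ t : ℝ), 0 ≤ η →
      (∀ r, 0 < r → r ≤ δ → σ (Metric.ball x₀ r) ≤ ENNReal.ofReal (η * r ^ n)) →
      1 / 2 ^ t ≤ δ / 2 →
      ∫⁻ y in Metric.ball x₀ (δ / 2), ‖kernel φ t x₀ y‖ₑ ∂σ ≤ ENNReal.ofReal (η * S) := by
  obtain ⟨C, hC, h⟩ := hφ.norm_kernel_le hM 1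
  obtain ⟨a, ha, b, hab⟩ := exists_linear_le_growth hM
  have hsum : Summable fun i : ℕ => C * Real.exp b * Real.exp (-(a * i)) * ((i : ℝ) + 1) ^ n := by
    have h1 := (summable_nat_add_iff 1).2 (Real.summable_pow_mul_exp_neg_nat_mul n ha)
    refine (h1.mul_left (C * Real.exp b * Real.exp a)).congr fun i => ?_
    have : Real.exp (-(a * i)) = Real.exp a * Real.exp (-a * ((i + 1 : ℕ) : ℝ)) := by
      rw [← Real.exp_add]; push_cast; ring_nf
    rw [this]; push_cast; ring
  have hpos : ∀ i : ℕ, 0 ≤ C * Real.exp b * Real.exp (-(a * i)) * ((i : ℝ) + 1) ^ n :=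
    fun i => by positivity
  refine ⟨∑' i : ℕ, C * Real.exp b * Real.exp (-(a * i)) * ((i : ℝ) + 1) ^ n, tsum_nonneg hpos,
    fun σ x₀ η δ t hη hσ ht => ?_⟩
  set s : ℝ := 2 ^ t with hs
  have hs0 : 0 < s := Real.rpow_pos_of_pos two_pos t
  -- The bound for the kernel where `s|y - x₀|` has integer part `i`. Radii beyond `δ`, where `σ` is
  -- not controlled, get weight zero; they never occur for `|y - x₀| < δ/2`, as `1/s ≤ δ/2`.
  set w : ℕ → ℝ≥0∞ := fun i => if ((i : ℝ) + 1) / s ≤ δ then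
    ENNReal.ofReal (C * s ^ n * (Real.exp b * Real.exp (-(a * i)))) else 0 with hw
  have hpt : ∀ y ∈ Metric.ball x₀ (δ / 2), ‖kernel φ t x₀ y‖ₑ ≤
      ∑' i : ℕ, w i * (Metric.ball x₀ (((i : ℝ) + 1) / s)).indicator 1 y := by
    intro y hy
    rw [mem_ball_iff_norm] at hy
    have hi1 := Nat.floor_le (a := s * ‖y - x₀‖) (by positivity)
    have hi2 := Nat.lt_floor_add_one (s * ‖y - x₀‖)
    set i := ⌊s * ‖y - x₀‖⌋₊ with hi
    refine le_trans ?_ (ENNReal.le_tsum i)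
    have hmem : y ∈ Metric.ball x₀ (((i : ℝ) + 1) / s) := by
      rw [mem_ball_iff_norm, lt_div_iff₀ hs0, mul_comm]
      exact hi2
    have hle : ((i : ℝ) + 1) / s ≤ δ := by
      have : (i : ℝ) / s ≤ ‖y - x₀‖ := by rwa [div_le_iff₀ hs0, mul_comm]
      rw [add_div]
      linarith
    rw [Set.indicator_of_mem hmem, hw]
    simp only [if_pos hle, Pi.one_apply, mul_one]
    rw [← ofReal_norm]
    refine ENNReal.ofReal_le_ofReal ((h t x₀ y).trans ?_)
    rw [← Real.exp_add]
    refine mul_le_mul_of_nonneg_left (Real.exp_le_exp.2 ?_) (by positivity)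
    have h3 := hab (((1 : ℕ) : ℝ) * s * ‖x₀ - y‖)
    rw [norm_sub_rev, Nat.cast_one, one_mul] at h3 ⊢
    nlinarith
  calc ∫⁻ y in Metric.ball x₀ (δ / 2), ‖kernel φ t x₀ y‖ₑ ∂σ
      ≤ ∫⁻ y in Metric.ball x₀ (δ / 2),
          ∑' i : ℕ, w i * (Metric.ball x₀ (((i : ℝ) + 1) / s)).indicator 1 y ∂σ :=
        setLIntegral_mono' measurableSet_ball hpt
    _ ≤ ∫⁻ y, ∑' i : ℕ, w i * (Metric.ball x₀ (((i : ℝ) + 1) / s)).indicator 1 y ∂σ :=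
        setLIntegral_le_lintegral _ _
    _ = ∑' i : ℕ, w i * σ (Metric.ball x₀ (((i : ℝ) + 1) / s)) := by
        have hmeas : ∀ i : ℕ, Measurable ((Metric.ball x₀ (((i : ℝ) + 1) / s)).indicator
            (1 : Rn n → ℝ≥0∞)) := fun i => measurable_one.indicator measurableSet_ball
        rw [lintegral_tsum fun i => ((hmeas i).const_mul _).aemeasurable]
        refine tsum_congr fun i => ?_
        rw [lintegral_const_mul _ (hmeas i), lintegral_indicator_one measurableSet_ball]
    _ ≤ ∑' i : ℕ, ENNReal.ofReal
          (η * (C * Real.exp b * Real.exp (-(a * i)) * ((i : ℝ) + 1) ^ n)) := by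
        refine ENNReal.tsum_le_tsum fun i => ?_
        rw [hw]
        by_cases hle : ((i : ℝ) + 1) / s ≤ δ
        · simp only [if_pos hle]
          refine (mul_le_mul_right (hσ _ (by positivity) hle) _).trans_eq ?_
          rw [← ENNReal.ofReal_mul (by positivity)]
          congr 1
          -- The factor `s^n` of the kernel cancels against the volume scale `((i + 1)/s)^n`, so the
          -- bound does not depend on `t`.
          rw [div_pow]
          field_simp
        · simp [hle]
    _ = _ := by
        rw [← ENNReal.ofReal_tsum_of_nonneg (fun i => mul_nonneg hη (hpos i))
          (hsum.mul_left η), tsum_mul_left]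

/-- The contribution of the complement of a ball to the integral of the kernel. -/
lemma HasDecay.setLIntegral_compl_ball_kernel (hM : IsGrowthFunction M) (hφ : HasDecay M φ)
    {σ : Measure (Rn n)} {k : ℝ} (hk : 0 ≤ k)
    (hσ : ∫⁻ y, ENNReal.ofReal (Real.exp (-growth M (k * ‖y‖))) ∂σ < ∞) (x₀ : Rn n) {d : ℝ}
    (hd : 0 < d) :
    Tendsto (fun t : ℝ => ∫⁻ y in (Metric.ball x₀ d)ᶜ, ‖kernel φ t x₀ y‖ₑ ∂σ) atTop (𝓝 0) := by
  obtain ⟨C, hC, h⟩ := hφ.norm_kernel_le hM 1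
  obtain ⟨a, ha, b, hab⟩ := exists_linear_le_growth hM
  set I := ∫⁻ y, ENNReal.ofReal (Real.exp (-growth M (k * ‖y‖))) ∂σ with hI
  set D : ℝ := b + growth M (2 * k * ‖x₀‖) + a * (2 * k) * d with hD
  clear_value D
  have hpow : Tendsto (fun t : ℝ => (2 : ℝ) ^ t) atTop atTop :=
    tendsto_rpow_atTop_of_base_gt_one 2 one_lt_two
  have hQ : Tendsto (fun t : ℝ => C * ((2 : ℝ) ^ t) ^ n * Real.exp (D - a * d * 2 ^ t)) atTop
      (𝓝 0) := by
    have h1 : Tendsto (fun s : ℝ => C * s ^ n * Real.exp (D - a * d * s)) atTop (𝓝 0) := by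
      have h2 := ((Real.tendsto_pow_mul_exp_neg_atTop_nhds_zero n).comp
        (tendsto_id.const_mul_atTop (show 0 < a * d by positivity))).const_mul
          (C * Real.exp D / (a * d) ^ n)
      rw [mul_zero] at h2
      refine h2.congr fun s => ?_
      simp only [Function.comp_apply, id_eq]
      rw [sub_eq_add_neg, Real.exp_add]
      field_simp
      ring
    exact h1.comp hpow
  have hQ' : Tendsto (fun t : ℝ => ENNReal.ofReal
      (C * ((2 : ℝ) ^ t) ^ n * Real.exp (D - a * d * 2 ^ t)) * I) atTop (𝓝 0) := by
    have := ENNReal.Tendsto.mul_const (ENNReal.tendsto_ofReal hQ) (b := I) (Or.inr hσ.ne)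
    simpa using this
  refine tendsto_of_tendsto_of_tendsto_of_le_of_le' tendsto_const_nhds hQ'
    (Eventually.of_forall fun _ => zero_le) ?_
  filter_upwards [hpow.eventually_ge_atTop (2 * k)] with t ht
  have hs0 : (0 : ℝ) < 2 ^ t := Real.rpow_pos_of_pos two_pos t
  have hexpm : Measurable fun y : Rn n => ENNReal.ofReal (Real.exp (-growth M (k * ‖y‖))) :=
    (((growth_measurable hM).comp (measurable_const.mul measurable_norm)).neg.exp).ennreal_ofReal
  rw [hI, ← lintegral_const_mul _ hexpm]
  refine le_trans (setLIntegral_mono' measurableSet_ball.compl fun y hy => ?_)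
    (setLIntegral_le_lintegral _ _)
  rw [Set.mem_compl_iff, mem_ball_iff_norm, not_lt] at hy
  rw [← ofReal_norm, ← ENNReal.ofReal_mul (by positivity)]
  refine ENNReal.ofReal_le_ofReal ((h t x₀ y).trans ?_)
  rw [mul_assoc _ (Real.exp _), ← Real.exp_add]
  refine mul_le_mul_of_nonneg_left (Real.exp_le_exp.2 ?_) (by positivity)
  set s : ℝ := 2 ^ t with hs
  rw [norm_sub_rev, Nat.cast_one, one_mul]
  have h3 := growth_mul_norm_le hM hk x₀ y
  -- Superadditivity splits `M (s|y - x₀|)`: the part with `2k` reproduces the integrable weight,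
  -- and the part with `s - 2k` gives exponential decay in `s`, which beats `s^n`.
  have h4 := growth_add_le hM (r := 2 * k * ‖y - x₀‖) (s := (s - 2 * k) * ‖y - x₀‖) (by positivity)
    (mul_nonneg (sub_nonneg.2 ht) (norm_nonneg _))
  rw [← add_mul, add_sub_cancel] at h4
  have h5 := hab ((s - 2 * k) * ‖y - x₀‖)
  have h6 : a * ((s - 2 * k) * d) ≤ a * ((s - 2 * k) * ‖y - x₀‖) :=
    mul_le_mul_of_nonneg_left (mul_le_mul_of_nonneg_left hy (sub_nonneg.2 ht)) ha.le
  rw [hD]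
  nlinarith

theorem HasDecay.tendsto_lintegral_kernel (hM : IsGrowthFunction M) (hφ : HasDecay M φ)
    {σ : Measure (Rn n)} {k : ℝ} (hk : 0 ≤ k)
    (hσ : ∫⁻ y, ENNReal.ofReal (Real.exp (-growth M (k * ‖y‖))) ∂σ < ∞) {x₀ : Rn n}
    (hx₀ : ∀ η > 0, ∃ δ > 0, ∀ r, 0 < r → r ≤ δ →
      σ (Metric.ball x₀ r) ≤ ENNReal.ofReal (η * r ^ n)) :
    Tendsto (fun t : ℝ => ∫⁻ y, ‖kernel φ t x₀ y‖ₑ ∂σ) atTop (𝓝 0) := by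
  rw [ENNReal.tendsto_nhds_zero]
  intro ε hε
  obtain ⟨e, he0, he⟩ := ENNReal.lt_iff_exists_nnreal_btwn.1 hε
  have he0' : (0 : ℝ) < e := by exact_mod_cast he0
  obtain ⟨S, hS, hnear⟩ := hφ.setLIntegral_ball_kernel_le hM
  obtain ⟨δ, hδ, hball⟩ := hx₀ (e / 2 / (S + 1)) (by positivity)
  have hfar := hφ.setLIntegral_compl_ball_kernel hM hk hσ x₀ (half_pos hδ)
  have hpow : Tendsto (fun t : ℝ => (2 : ℝ) ^ t) atTop atTop :=
    tendsto_rpow_atTop_of_base_gt_one 2 one_lt_two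
  filter_upwards [hpow.eventually_ge_atTop (2 / δ),
    hfar.eventually_le_const (u := ENNReal.ofReal (e / 2)) (ENNReal.ofReal_pos.2 (half_pos he0'))]
    with t ht hft
  have hs0 : (0 : ℝ) < 2 ^ t := Real.rpow_pos_of_pos two_pos t
  rw [← lintegral_add_compl _ (measurableSet_ball : MeasurableSet (Metric.ball x₀ (δ / 2)))]
  have ht' : 1 / 2 ^ t ≤ δ / 2 := by
    rw [div_le_iff₀ hδ] at ht
    rw [div_le_iff₀ hs0]
    linarith
  calc _ ≤ ENNReal.ofReal (e / 2 / (S + 1) * S) + ENNReal.ofReal (e / 2) :=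
        add_le_add (hnear σ x₀ _ δ t (by positivity) hball ht') hft
    _ ≤ ENNReal.ofReal (e / 2) + ENNReal.ofReal (e / 2) := by
        gcongr
        rw [div_mul_eq_mul_div, div_le_iff₀ (by positivity)]
        nlinarith
    _ = e := by rw [← ENNReal.ofReal_add (by positivity) (by positivity), add_halves]; simp
    _ ≤ ε := he.le

/-- Convergence of the expansions at the density points. -/
theorem tendsto_expansion (hn : n ≠ 0) (hM : IsGrowthFunction M) (hφ : HasDecay M φ)
    (hc : Continuous φ) {V : ℤ → Submodule ℂ (L2 n)} (hV : IsMRA V)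
    (hS : IsScalingFunction (V 0) φ) {μ : ComplexRadonMeasure n} {k : ℝ} (hk : 0 ≤ k)
    (hμ : ∫⁻ y, ENNReal.ofReal (Real.exp (-growth M (k * ‖y‖))) ∂μ.variation < ∞)
    {x₀ : Rn n} {γ : ℂ} (hx₀ : IsLebesgueDensityPoint μ x₀ γ) :
    Tendsto (fun t : ℝ => expansion φ μ t x₀) atTop (𝓝 γ) := by
  have hvol := lintegral_exp_neg_growth_lt_top (n := n) hM le_rfl
  have hneg := hx₀.isNegligibleAt hn
  set ρ := μ.subConst γ with hρ
  -- Raising `k` to at least `1` makes the weight integrable for Lebesgue measure too, hence for the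
  -- variation of `μ - γ m`.
  have hk' : 0 ≤ max k 1 := hk.trans (le_max_left _ _)
  have hρfin : ∫⁻ y, ENNReal.ofReal (Real.exp (-growth M (max k 1 * ‖y‖))) ∂ρ.variation < ∞ := by
    refine (lintegral_mono' (μ.variation_subConst_le γ) le_rfl).trans_lt ?_
    rw [lintegral_add_measure, lintegral_smul_measure]
    refine ENNReal.add_lt_top.2 ⟨lt_of_le_of_lt (lintegral_mono fun y => ?_) hμ,
      ENNReal.mul_lt_top enorm_lt_top (lintegral_exp_neg_growth_lt_top hM (le_max_right _ _))⟩
    refine ENNReal.ofReal_le_ofReal (Real.exp_le_exp.2 (neg_le_neg (growth_mono hM ?_)))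
    gcongr
    exact le_max_left _ _
  have hmain := hφ.tendsto_lintegral_kernel hM hk' hρfin
    (fun η hη => hneg.variation_ball_le hη)
  have heq : ∀ t, ρ.integral (fun y => kernel φ t x₀ y) = expansion φ μ t x₀ - γ := by
    intro t
    rw [hρ, ComplexRadonMeasure.integral_subConst μ γ (hφ.integrable_kernel hM hc hk hμ t x₀)
      (hφ.integrable_kernel hM hc zero_le_one hvol t x₀), integral_kernel_eq_one hM hφ hc hV hS,
      mul_one, expansion]
  have h0 : Tendsto (fun t : ℝ => expansion φ μ t x₀ - γ) atTop (𝓝 0) := by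
    rw [tendsto_zero_iff_enorm_tendsto_zero]
    refine tendsto_of_tendsto_of_tendsto_of_le_of_le tendsto_const_nhds hmain
      (fun _ => zero_le) fun t => ?_
    simp only [← heq]
    exact ρ.enorm_integral_le _
  simpa using h0.add_const γ

end KernelIntegral

/-! ### Lebesgue decomposition and differentiation. -/

section LebesgueDecomposition

variable {n : ℕ}

/-- Reduces to the real and imaginary parts, whose variations are sums of the singular parts of
their Jordan components. -/
lemma variation_singularPart_mutuallySingular {X : Type*} [MeasurableSpace X] (c : ComplexMeasure X)
    (m : Measure X) : (c.singularPart m).variation ⟂ₘ m := by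
  have h : ∀ s : SignedMeasure X, (s.singularPart m).variation ⟂ₘ m := by
    intro s
    rw [← SignedMeasure.totalVariation_eq_variation, SignedMeasure.singularPart_totalVariation]
    exact (Measure.mutuallySingular_singularPart _ _).add_left
      (Measure.mutuallySingular_singularPart _ _)
  refine Measure.MutuallySingular.mono ?_ (variation_le_re_add_im _) le_rfl
  rw [ComplexMeasure.singularPart, SignedMeasure.re_toComplexMeasure,
    SignedMeasure.im_toComplexMeasure]
  exact (h _).add_left (h _)

/-- The density of the absolutely continuous part, glued from the shells. -/
noncomputable def ComplexRadonMeasure.density (μ : ComplexRadonMeasure n) (x : Rn n) : ℂ :=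
  (μ.shellPart ⌊‖x‖⌋₊).rnDeriv volume x

namespace ComplexRadonMeasure

lemma density_eq_of_mem_shell (μ : ComplexRadonMeasure n) {N : ℕ} {x : Rn n} (hx : x ∈ shell n N) :
    μ.density x = (μ.shellPart N).rnDeriv volume x := by
  rw [density, (Nat.floor_eq_iff (norm_nonneg x)).2 hx]

lemma integrableOn_density_shell (μ : ComplexRadonMeasure n) (N : ℕ) :
    IntegrableOn μ.density (shell n N) :=
  ((μ.shellPart N).integrable_rnDeriv volume).integrableOn.congr_fun
    (fun _ hx => (μ.density_eq_of_mem_shell hx).symm) (measurableSet_shell N)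

lemma integrableOn_density (μ : ComplexRadonMeasure n) {K : Set (Rn n)}
    (hb : Bornology.IsBounded K) : IntegrableOn μ.density K := by
  obtain ⟨R, hR⟩ := hb.exists_norm_le
  refine ((integrableOn_finset_iUnion (s := Finset.range (⌊R⌋₊ + 1))).2
    fun N _ => μ.integrableOn_density_shell N).mono_set fun x hx => ?_
  refine Set.mem_iUnion₂.2 ⟨⌊‖x‖⌋₊, Finset.mem_range.2 ?_,
    Nat.floor_le (norm_nonneg _), Nat.lt_floor_add_one _⟩
  exact Nat.lt_succ_of_le (Nat.floor_le_floor (hR x hx))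

/-- The difference of `μ` and its absolutely continuous part. -/
noncomputable def singular (μ : ComplexRadonMeasure n) : ComplexRadonMeasure n where
  toFun B := μ.toFun B - ∫ x in B, μ.density x
  empty' := by simp [μ.empty']
  hasSum_iUnion' B hB hd hb := (μ.hasSum_iUnion' B hB hd hb).sub
    (hasSum_integral_iUnion hB hd (μ.integrableOn_density hb))

lemma isLebesgueDecomposition_singular (μ : ComplexRadonMeasure n) :
    IsLebesgueDecomposition μ μ.density μ.singular where
  locallyIntegrable :=
    locallyIntegrable_iff.2 fun _ hK => μ.integrableOn_density hK.isBounded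
  singular := by
    refine Measure.MutuallySingular.sum_left.2 fun N => ?_
    refine (variation_singularPart_mutuallySingular (μ.shellPart N) volume).mono ?_ le_rfl
    refine VectorMeasure.variation_le_of_forall_enorm_le fun A hA => ?_
    have hAN := hA.inter (measurableSet_shell (n := n) N)
    have : (μ.shellPart N).HaveLebesgueDecomposition volume := ⟨inferInstance, inferInstance⟩
    have h1 : (μ.singular.shellPart N) A =
        (μ.shellPart N).singularPart volume (A ∩ shell n N) := by
      have h2 := congrArg (fun v : ComplexMeasure (Rn n) => v (A ∩ shell n N))
        ((μ.shellPart N).singularPart_add_withDensity_rnDeriv_eq (μ := volume))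
      simp only [add_apply] at h2
      rw [withDensityᵥ_apply ((μ.shellPart N).integrable_rnDeriv volume) hAN,
        shellPart_apply _ _ hAN, Set.inter_assoc, Set.inter_self] at h2
      rw [shellPart_apply _ _ hA]
      change μ.toFun (A ∩ shell n N) - ∫ x in A ∩ shell n N, μ.density x = _
      rw [setIntegral_congr_fun hAN fun x hx => μ.density_eq_of_mem_shell hx.2, ← h2,
        add_sub_cancel_right]
    rw [h1]
    exact (VectorMeasure.enorm_measure_le_variation _ _).trans
      (measure_mono Set.inter_subset_left)
  eq_add B _ _ := by
    change _ = _ + (μ.toFun B - _)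
    rw [add_sub_cancel]

end ComplexRadonMeasure

lemma volume_real_closedBall (x : Rn n) {r : ℝ} (hr : 0 < r) :
    volume.real (Metric.closedBall x r) = r ^ n * volume.real (Metric.ball (0 : Rn n) 1) := by
  rw [measureReal_def, Measure.addHaar_closedBall _ _ hr.le, finrank_euclideanSpace_fin,
    ENNReal.toReal_mul, ENNReal.toReal_ofReal (by positivity), measureReal_def]

/-- Lebesgue's differentiation theorem for complex Radon measures. -/
lemma IsLebesgueDecomposition.ae_isLebesgueDensityPoint {μ μs : ComplexRadonMeasure n}
    {f : Rn n → ℂ} (h : IsLebesgueDecomposition μ f μs) :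
    ∀ᵐ x : Rn n, IsLebesgueDensityPoint μ x (f x) := by
  set v := IsUnifLocDoublingMeasure.vitaliFamily (volume : Measure (Rn n)) 1
  filter_upwards [v.ae_tendsto_average_norm_sub h.locallyIntegrable,
    v.ae_eventually_measure_zero_of_singular h.singular] with x h1 h2
  have hball : Tendsto (fun r => Metric.closedBall x r) (𝓝[>] 0) (v.filterAt x) := by
    refine IsUnifLocDoublingMeasure.tendsto_closedBall_filterAt volume (fun _ : ℝ => x) id
      tendsto_id ?_
    filter_upwards [self_mem_nhdsWithin] with r hr
    exact Metric.mem_closedBall_self (by simpa using (le_of_lt hr))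
  -- Mean oscillation of `f` and relative mass of the singular part, both over closed balls; their
  -- sum bounds `μ - f(x) m` on every Borel subset.
  have h3 := (h1.comp hball).add
    ((ENNReal.tendsto_toReal ENNReal.zero_ne_top).comp (h2.comp hball))
  rw [ENNReal.toReal_zero, add_zero] at h3
  set κ := volume.real (Metric.ball (0 : Rn n) 1) with hκ
  have hκ0 : 0 < κ := volume_real_unitBall_pos
  refine IsNegligibleAt.isLebesgueDensityPoint fun η hη => ?_
  -- Division by `κ`, the volume of the unit ball, converts averages over balls into multiples of
  -- `r^n`.
  obtain ⟨δ, hδ, hδs⟩ := mem_nhdsGT_iff_exists_Ioc_subset.1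
    (h3.eventually_lt_const (div_pos hη hκ0))
  refine ⟨δ, hδ, fun r hr hrδ A hAr hA => ?_⟩
  have h4 := hδs ⟨hr, hrδ⟩
  simp only [Set.mem_ofPred_eq, Function.comp_apply] at h4
  set U := Metric.closedBall x r with hU
  have hAU : A ⊆ U := hAr.trans Metric.ball_subset_closedBall
  have hAb : Bornology.IsBounded A := Metric.isBounded_ball.subset hAr
  have hUvol : volume.real U = r ^ n * κ := volume_real_closedBall x hr
  have hrn : 0 < r ^ n := pow_pos hr n
  have hfU : IntegrableOn f U := h.locallyIntegrable.integrableOn_isCompact (isCompact_closedBall x r)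
  have hUfin : volume U ≠ ∞ := measure_closedBall_lt_top.ne
  have hcU : IntegrableOn (fun _ : Rn n => f x) U := integrableOn_const hUfin
  have hρ : (μ.subConst (f x)).toFun A = (∫ y in A, (f y - f x)) + μs.toFun A := by
    rw [ComplexRadonMeasure.subConst_toFun, h.eq_add A hA hAb,
      integral_sub (hfU.mono_set hAU) (hcU.mono_set hAU), setIntegral_const, Complex.real_smul]
    ring
  have b1 : ‖∫ y in A, (f y - f x)‖ ≤ ∫ y in U, ‖f y - f x‖ :=
    (norm_integral_le_integral_norm _).trans
      (setIntegral_mono_set (hfU.sub hcU).norm (ae_of_all _ fun _ => norm_nonneg _)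
        hAU.eventuallyLE)
  have hsfin : μs.variation U ≠ ∞ :=
    (μs.variation_lt_top measurableSet_closedBall Metric.isBounded_closedBall).ne
  have b2 : ‖μs.toFun A‖ ≤ (μs.variation U).toReal := by
    rw [← toReal_enorm]
    exact ENNReal.toReal_mono hsfin ((μs.enorm_toFun_le hA hAb).trans (measure_mono hAU))
  rw [setAverage_eq, smul_eq_mul, ENNReal.toReal_div, ← measureReal_def volume U, hUvol,
    inv_mul_eq_div, ← add_div, div_lt_div_iff₀ (by positivity) hκ0] at h4
  rw [hρ]
  refine (norm_add_le _ _).trans ((add_le_add b1 b2).trans ?_)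
  refine le_of_mul_le_mul_right ?_ hκ0
  linarith

end LebesgueDecomposition

/-- In dimension zero dilation is the identity, so all `V_j` coincide with their intersection `0`,
which contains no unit vector. -/
lemma IsMRA.dim_ne_zero {n : ℕ} {V : ℤ → Submodule ℂ (L2 n)} (hV : IsMRA V) {φ : Rn n → ℂ}
    (hφ : IsScalingFunction (V 0) φ) : n ≠ 0 := by
  rintro rfl
  have hstep : ∀ j, V j = V (j + 1) := by
    intro j
    ext f
    exact hV.dilation j f f (ae_of_all _ fun x => by rw [Subsingleton.elim ((2 : ℝ) • x) x])
  have hall : ∀ j, V j = V 0 := by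
    intro j
    induction j using Int.induction_on with
    | zero => rfl
    | succ i ih => rw [← hstep, ih]
    | pred i ih => rw [hstep, sub_add_cancel, ih]
  have hbot : V 0 = ⊥ := by
    rw [← hV.iInf_eq_bot]
    simp only [hall, iInf_const]
  obtain ⟨h, hon, hspan⟩ := hφ
  have hmem : (h 0).toLp ∈ V 0 := by
    rw [← hspan]
    exact Submodule.le_topologicalClosure _ (Submodule.subset_span ⟨0, rfl⟩)
  rw [hbot, Submodule.mem_bot] at hmem
  have : ‖(h 0).toLp‖ = 1 := hon.1 0
  rw [hmem, norm_zero] at this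
  exact zero_ne_one this

end MRAPointwise

theorem corollary4p4 (n : ℕ) (M : ℝ≥0 → ℝ≥0) (hM : IsGrowthFunction M)
    (V : ℤ → Submodule ℂ (L2 n)) (hV : IsMRA V)
    (φ : Rn n → ℂ) (hφ : IsScalingFunction (V 0) φ) (hφ_cont : Continuous φ)
    (hφ_decay : ∀ l : ℕ, Tendsto (fun x => Real.exp (M ((l : ℝ≥0) * ‖x‖₊)) • φ x)
      (cocompact (Rn n)) (𝓝 0))
    (μ : ComplexRadonMeasure n) (k : ℝ≥0)
    (hμ : ∫⁻ x, ENNReal.ofReal (Real.exp (-(M (k * ‖x‖₊) : ℝ))) ∂μ.variation < ∞) :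
    -- the multiresolution expansion of `μ` is well defined
    (∀ x y, Summable (kernelTerm φ x y)) ∧
    (∀ (t : ℝ) (x : Rn n), Integrable (fun y => kernel φ t x y) μ.variation) ∧
    -- convergence at the Lebesgue density points
    (∀ (x₀ : Rn n) (γ : ℂ), IsLebesgueDensityPoint μ x₀ γ →
      Tendsto (fun t : ℝ => expansion φ μ t x₀) atTop (𝓝 γ)) ∧
    -- almost everywhere convergence to the density of the absolutely continuous part
    (∃ f μs, IsLebesgueDecomposition μ f μs) ∧
    (∀ f μs, IsLebesgueDecomposition μ f μs → ∀ᵐ x₀ : Rn n,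
      IsLebesgueDensityPoint μ x₀ (f x₀) ∧
        Tendsto (fun t : ℝ => expansion φ μ t x₀) atTop (𝓝 (f x₀))) := by
  have hn := hV.dim_ne_zero hφ
  have hdecay := hasDecay_of_tendsto hM hφ_cont hφ_decay
  have hμ' : ∫⁻ x, ENNReal.ofReal (Real.exp (-growth M ((k : ℝ) * ‖x‖))) ∂μ.variation < ∞ := by
    simpa only [growth_norm] using hμ
  have hlim : ∀ (x₀ : Rn n) (γ : ℂ), IsLebesgueDensityPoint μ x₀ γ →
      Tendsto (fun t : ℝ => expansion φ μ t x₀) atTop (𝓝 γ) := fun x₀ γ h =>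
    tendsto_expansion hn hM hdecay hφ_cont hV hφ k.coe_nonneg hμ' h
  refine ⟨fun x y => (hdecay.summable_norm_kernelTerm hM x y).of_norm,
    fun t x => hdecay.integrable_kernel hM hφ_cont k.coe_nonneg hμ' t x, hlim,
    ⟨_, _, μ.isLebesgueDecomposition_singular⟩, fun f μs h => ?_⟩
  filter_upwards [h.ae_isLebesgueDensityPoint] with x hx
  exact ⟨hx, hlim x _ hx⟩
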